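/- Let $p,q\ge 0$ be polynomial degrees and $m,n$ integers, with open knot vectors $0=s_1=\dots=s_{p+1}<s_{p+2}\le\dots\le s_{m-p-1}<s_{m-p}=\dots=s_m=1$ and $0=t_1=\dots=t_{q+1}<t_{q+2}\le\dots\le t_{n-q-1}<t_{n-q}=\dots=t_n=1$ (so $m\ge 2p+2$, $n\ge 2q+2$). A **T-mesh** $\mathsf T$ is a partition of $[1,m]\times[1,n]$ into non-overlapping open rectangles (cells) whose corners (the vertices) have integer coordinates. Its horizontal (vertical) skeleton is the union of all horizontal (vertical) closed cell sides, and an edge is a segment of the skeleton joining two adjacent vertices. The active region is $[1+\lfloor\frac{p+1}2\rfloor,\,m-\lfloor\frac{p+1}2\rfloor]\times[1+\lfloor\frac{q+1}2\rfloor,\,n-\lfloor\frac{q+1}2\rfloor]$, and the frame region is the closure of its complement in $[1,m]\times[1,n]$. $\mathsf T$ is **admissible** if its skeleton contains the lines $\{i\}\times[1,n]$ for $1\le i\le 1+\lfloor\frac{p+1}2\rfloor$ and $m-\lfloor\frac{p+1}2\rfloor\le i\le m$ and the lines $[1,m]\times\{j\}$ for $1\le j\le 1+\lfloor\frac{q+1}2\rfloor$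 and $n-\lfloor\frac{q+1}2\rfloor\le j\le n$, and every vertex of the frame region lying in $(1,m)\times(1,n)$ has valence four. A T-junction is a vertex in $(1,m)\times(1,n)$ of valence three; it is horizontal (vertical) if a horizontal (vertical) edge is missing. The **extension** of a horizontal T-junction is the closed horizontal segment through it that reaches, in the direction of the missing edge, to the $\lfloor\frac{p+1}2\rfloor$-th next point of the vertical skeleton on that line and, in the opposite direction, to the $\lceil\frac{p-1}2\rceil$-th next such point; extensions of vertical T-junctions are defined in the same way with $q$ and the horizontal skeleton. $\mathsf T$ is **analysis-suitable** if no extension of a horizontal T-junction intersects an extension of a vertical T-junction (common end points count as intersections). The extended T-mesh is $\mathsf T$ with all extensions added. A **Bézier element** is a cell $(i_l,i_r)\times(j_b,j_t)$ of the extended T-mesh with positive parametric area; its parametric domain is $\hat\Omega^e=(s_{i_l},s_{i_r})\times(t_{j_b},t_{j_t})$. The **anchors** $A=a\times b$ are the vertices ($p,q$ odd), horizontal edges ($p$ even, $q$ odd), vertical edges ($p$ odd, $q$ even) or cells ($p,q$ even) of $\mathsf T$ contained in the active region. The horizontal local index vector $(i_1,\dots,i_{p+2})$ of $A$ consists of consecutive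 elements of the set of those $i$ for which $\{i\}\times b$ lies in the vertical skeleton, positioned so that $a=\{i_{(p+3)/2}\}$ if $p$ is odd and $a=(i_{p/2+1},i_{p/2+2})$ if $p$ is even; the vertical local index vector $(j_1,\dots,j_{q+2})$ is defined in the same way. The blending function of $A$ is $$N_A(s,t)=N[s_{i_1},\dots,s_{i_{p+2}}](s)\;N[t_{j_1},\dots,t_{j_{q+2}}](t),$$ where $N[\cdot]$ is the univariate B-spline on the given knots, defined by the Cox–de Boor recursion (with quotients by zero equal to zero). **Theorem.** The blending functions of an analysis-suitable T-spline are locally linearly independent: if $\mathsf T$ is admissible and analysis-suitable, then for every Bézier element with parametric domain $\hat\Omega^e$ the restrictions to $\hat\Omega^e$ of the blending functions $N_A$, indexed by the anchors $A$ for which $N_A$ is not identically zero on $\hat\Omega^e$, are linearly independent over $\mathbb R$. -/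

import Mathlib

noncomputable section

namespace TSpline

/-- The rectangle `[left, right] × [bottom, top]` of the index plane. Degenerate rectangles
represent points (`left = right`, `bottom = top`) and line segments. -/
@[ext]
structure IndexRect where
  left : ℕ
  right : ℕ
  bottom : ℕ
  top : ℕ

/-- A T-mesh: a rectangular partition of the index domain `[1, m] × [1, n]` all of whose vertices
have integer coordinates. The cells are the open rectangles
`(left, right) × (bottom, top)`; that they do not overlap and that their closures cover the index
domain means that each unit square `(i, i+1) × (j, j+1)` of the index domain lies in exactly one
of them. -/
structure TMesh (m n : ℕ) where
  cells : Set IndexRect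
  cell_horizontal : ∀ C ∈ cells, 1 ≤ C.left ∧ C.left < C.right ∧ C.right ≤ m
  cell_vertical : ∀ C ∈ cells, 1 ≤ C.bottom ∧ C.bottom < C.top ∧ C.top ≤ n
  partition : ∀ i j : ℕ, 1 ≤ i → i < m → 1 ≤ j → j < n →
    ∃! C : IndexRect, C ∈ cells ∧
      (C.left ≤ i ∧ i < C.right) ∧ (C.bottom ≤ j ∧ j < C.top)

/-- The smallest element of `I` greater than `i`. -/
def nextIndex (I : Set ℕ) (i : ℕ) : ℕ := sInf {x | x ∈ I ∧ i < x}

/-- The largest element of `I` smaller than `i`. -/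
def prevIndex (I : Set ℕ) (i : ℕ) : ℕ := sSup {x | x ∈ I ∧ x < i}

namespace TMesh

variable {m n : ℕ} (T : TMesh m n)

/-- `(i, j)` is a vertex of the mesh, i.e. a corner of a cell. -/
def IsVertex (i j : ℕ) : Prop :=
  ∃ C ∈ T.cells, (i = C.left ∨ i = C.right) ∧ (j = C.bottom ∨ j = C.top)

/-- The unit segment `{i} × [j, j+1]` lies in the vertical skeleton
(the union of all vertical sides of cells). -/
def VSeg (i j : ℕ) : Prop :=
  ∃ C ∈ T.cells, (i = C.left ∨ i = C.right) ∧ C.bottom ≤ j ∧ j < C.top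

/-- The unit segment `[i, i+1] × {j}` lies in the horizontal skeleton
(the union of all horizontal sides of cells). -/
def HSeg (i j : ℕ) : Prop :=
  ∃ C ∈ T.cells, (j = C.bottom ∨ j = C.top) ∧ C.left ≤ i ∧ i < C.right

/-- The point `(i, j)` lies in the vertical skeleton. -/
def VPoint (i j : ℕ) : Prop :=
  ∃ C ∈ T.cells, (i = C.left ∨ i = C.right) ∧ C.bottom ≤ j ∧ j ≤ C.top

/-- The point `(i, j)` lies in the horizontal skeleton. -/
def HPoint (i j : ℕ) : Prop :=
  ∃ C ∈ T.cells, (j = C.bottom ∨ j = C.top) ∧ C.left ≤ i ∧ i ≤ C.right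

/-- `{i} × [j₁, j₂]` (a point if `j₁ = j₂`) lies in the vertical skeleton. -/
def VSpan (i j₁ j₂ : ℕ) : Prop :=
  T.VPoint i j₁ ∧ ∀ j, j₁ ≤ j → j < j₂ → T.VSeg i j

/-- `[i₁, i₂] × {j}` (a point if `i₁ = i₂`) lies in the horizontal skeleton. -/
def HSpan (j i₁ i₂ : ℕ) : Prop :=
  T.HPoint i₁ j ∧ ∀ i, i₁ ≤ i → i < i₂ → T.HSeg i j

/-- `(i₁, i₂) × {j}` is a horizontal edge of the mesh: it joins two adjacent vertices inside the
skeleton. -/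
def IsHEdge (i₁ i₂ j : ℕ) : Prop :=
  i₁ < i₂ ∧ T.IsVertex i₁ j ∧ T.IsVertex i₂ j ∧ T.HSpan j i₁ i₂ ∧
    ∀ i, i₁ < i → i < i₂ → ¬ T.IsVertex i j

/-- `{i} × (j₁, j₂)` is a vertical edge of the mesh. -/
def IsVEdge (i j₁ j₂ : ℕ) : Prop :=
  j₁ < j₂ ∧ T.IsVertex i j₁ ∧ T.IsVertex i j₂ ∧ T.VSpan i j₁ j₂ ∧
    ∀ j, j₁ < j → j < j₂ → ¬ T.IsVertex i j

/-- `(i, j)` is a vertex in the open index domain `(1, m) × (1, n)`. -/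
def IsInteriorVertex (i j : ℕ) : Prop :=
  T.IsVertex i j ∧ (1 < i ∧ i < m) ∧ (1 < j ∧ j < n)

/-- An interior vertex of valence three at which the edge to the right is missing. -/
def IsTRight (i j : ℕ) : Prop :=
  T.IsInteriorVertex i j ∧
    ¬ T.HSeg i j ∧ T.HSeg (i - 1) j ∧ T.VSeg i j ∧ T.VSeg i (j - 1)

/-- An interior vertex of valence three at which the edge to the left is missing. -/
def IsTLeft (i j : ℕ) : Prop :=
  T.IsInteriorVertex i j ∧
    T.HSeg i j ∧ ¬ T.HSeg (i - 1) j ∧ T.VSeg i j ∧ T.VSeg i (j - 1)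

/-- An interior vertex of valence three at which the upward edge is missing. -/
def IsTUp (i j : ℕ) : Prop :=
  T.IsInteriorVertex i j ∧
    T.HSeg i j ∧ T.HSeg (i - 1) j ∧ ¬ T.VSeg i j ∧ T.VSeg i (j - 1)

/-- An interior vertex of valence three at which the downward edge is missing. -/
def IsTDown (i j : ℕ) : Prop :=
  T.IsInteriorVertex i j ∧
    T.HSeg i j ∧ T.HSeg (i - 1) j ∧ T.VSeg i j ∧ ¬ T.VSeg i (j - 1)

/-- All four edges at the (interior) vertex `(i, j)` are present. -/
def HasValenceFour (i j : ℕ) : Prop :=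
  T.HSeg i j ∧ T.HSeg (i - 1) j ∧ T.VSeg i j ∧ T.VSeg i (j - 1)

/-- Admissibility in bidegree `(p, q)`: the skeleton contains the full vertical lines
`{i} × [1, n]` with `i ≤ 1 + ⌊(p+1)/2⌋` or `i ≥ m - ⌊(p+1)/2⌋` and the full horizontal lines
`[1, m] × {j}` with `j ≤ 1 + ⌊(q+1)/2⌋` or `j ≥ n - ⌊(q+1)/2⌋`, and all vertices of the closed
frame region which are interior to the index domain have valence four. -/
structure IsAdmissible (p q : ℕ) : Prop where
  vertical_lines : ∀ i j : ℕ, 1 ≤ i → i ≤ m → 1 ≤ j → j < n →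
    (i ≤ 1 + (p + 1) / 2 ∨ m ≤ i + (p + 1) / 2) → T.VSeg i j
  horizontal_lines : ∀ i j : ℕ, 1 ≤ i → i < m → 1 ≤ j → j ≤ n →
    (j ≤ 1 + (q + 1) / 2 ∨ n ≤ j + (q + 1) / 2) → T.HSeg i j
  frame_valence : ∀ i j : ℕ, T.IsInteriorVertex i j →
    (i ≤ 1 + (p + 1) / 2 ∨ m ≤ i + (p + 1) / 2 ∨
      j ≤ 1 + (q + 1) / 2 ∨ n ≤ j + (q + 1) / 2) → T.HasValenceFour i j

/-- `[x₁, x₂] × {j}` is the (closed) extension of a horizontal T-junction `(i, j)`: the union of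
the face extension, which runs in the direction of the missing edge until `⌊(p+1)/2⌋` vertical
edges or vertices are met, and of the edge extension, which runs in the opposite direction until
`⌈(p-1)/2⌉ = ⌊p/2⌋` vertical edges or vertices are met. -/
def HExtension (p x₁ x₂ j : ℕ) : Prop :=
  ∃ i : ℕ,
    (T.IsTRight i j ∧
      x₁ = (prevIndex {x | T.VPoint x j})^[p / 2] i ∧
      x₂ = (nextIndex {x | T.VPoint x j})^[(p + 1) / 2] i) ∨
    (T.IsTLeft i j ∧
      x₁ = (prevIndex {x | T.VPoint x j})^[(p + 1) / 2] i ∧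
      x₂ = (nextIndex {x | T.VPoint x j})^[p / 2] i)

/-- `{i} × [y₁, y₂]` is the (closed) extension of a vertical T-junction. -/
def VExtension (q i y₁ y₂ : ℕ) : Prop :=
  ∃ j : ℕ,
    (T.IsTUp i j ∧
      y₁ = (prevIndex {y | T.HPoint i y})^[q / 2] j ∧
      y₂ = (nextIndex {y | T.HPoint i y})^[(q + 1) / 2] j) ∨
    (T.IsTDown i j ∧
      y₁ = (prevIndex {y | T.HPoint i y})^[(q + 1) / 2] j ∧
      y₂ = (nextIndex {y | T.HPoint i y})^[q / 2] j)

/-- No horizontal T-junction extension intersects a vertical T-junction extension. -/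
def IsAnalysisSuitable (p q : ℕ) : Prop :=
  ∀ x₁ x₂ j i y₁ y₂ : ℕ, T.HExtension p x₁ x₂ j → T.VExtension q i y₁ y₂ →
    ¬ ((x₁ ≤ i ∧ i ≤ x₂) ∧ (y₁ ≤ j ∧ j ≤ y₂))

/-- The unit segment `[i, i+1] × {j}` lies in the skeleton of the extended T-mesh. -/
def HSegExt (p i j : ℕ) : Prop :=
  T.HSeg i j ∨ ∃ x₁ x₂, T.HExtension p x₁ x₂ j ∧ x₁ ≤ i ∧ i < x₂

/-- The unit segment `{i} × [j, j+1]` lies in the skeleton of the extended T-mesh. -/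
def VSegExt (q i j : ℕ) : Prop :=
  T.VSeg i j ∨ ∃ y₁ y₂, T.VExtension q i y₁ y₂ ∧ y₁ ≤ j ∧ j < y₂

/-- `R` is a cell of the extended T-mesh: a nondegenerate rectangle in the index domain whose sides
lie in the extended skeleton and whose interior does not meet it. -/
structure IsExtCell (p q : ℕ) (R : IndexRect) : Prop where
  horizontal : 1 ≤ R.left ∧ R.left < R.right ∧ R.right ≤ m
  vertical : 1 ≤ R.bottom ∧ R.bottom < R.top ∧ R.top ≤ n
  left_right_sides : ∀ j, R.bottom ≤ j → j < R.top →
    T.VSegExt q R.left j ∧ T.VSegExt q R.right j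
  bottom_top_sides : ∀ i, R.left ≤ i → i < R.right →
    T.HSegExt p i R.bottom ∧ T.HSegExt p i R.top
  no_vertical_inside : ∀ i j, R.left < i → i < R.right → R.bottom ≤ j → j < R.top →
    ¬ T.VSegExt q i j
  no_horizontal_inside : ∀ i j, R.left ≤ i → i < R.right → R.bottom < j → j < R.top →
    ¬ T.HSegExt p i j

/-- The anchors `a × b`: the vertices (`p`, `q` odd), horizontal edges (`p` even, `q` odd),
vertical edges (`p` odd, `q` even) or cells (`p`, `q` even) of the T-mesh which lie in the active
region `[1 + ⌊(p+1)/2⌋, m - ⌊(p+1)/2⌋] × [1 + ⌊(q+1)/2⌋, n - ⌊(q+1)/2⌋]`. -/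
structure IsAnchor (p q : ℕ) (A : IndexRect) : Prop where
  active_horizontal : 1 + (p + 1) / 2 ≤ A.left ∧ A.right + (p + 1) / 2 ≤ m
  active_vertical : 1 + (q + 1) / 2 ≤ A.bottom ∧ A.top + (q + 1) / 2 ≤ n
  odd_odd : Odd p → Odd q → A.left = A.right ∧ A.bottom = A.top ∧ T.IsVertex A.left A.bottom
  even_odd : Even p → Odd q → A.bottom = A.top ∧ T.IsHEdge A.left A.right A.bottom
  odd_even : Odd p → Even q → A.left = A.right ∧ T.IsVEdge A.left A.bottom A.top
  even_even : Even p → Even q → A ∈ T.cells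

/-- The indices `i` such that the vertical skeleton at `i` spans the vertical component `b` of the
anchor `A = a × b`. -/
def hIndexSet (A : IndexRect) : Set ℕ := {i | T.VSpan i A.bottom A.top}

/-- The indices `j` such that the horizontal skeleton at `j` spans the horizontal component `a` of
the anchor `A = a × b`. -/
def vIndexSet (A : IndexRect) : Set ℕ := {j | T.HSpan j A.left A.right}

end TMesh

/-- The local index vector of degree `p`, with entries numbered `k = 0, …, p + 1`: consecutive
elements of `I`, with `a` in position `⌊(p+1)/2⌋` (the middle position for `p` odd, the left one of
the two middle positions for `p` even). -/
def localIndex (I : Set ℕ) (p a k : ℕ) : ℕ :=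
  if (p + 1) / 2 ≤ k then (nextIndex I)^[k - (p + 1) / 2] a
  else (prevIndex I)^[(p + 1) / 2 - k] a

open Classical in
/-- The Cox–de Boor recursion: `bspline κ p i` is the B-spline of degree `p` on the knots
`κ i ≤ … ≤ κ (i + p + 1)`; quotients with denominator zero are zero, as usual. -/
def bspline (κ : ℕ → ℝ) : ℕ → ℕ → ℝ → ℝ
  | 0, i, x => if κ i ≤ x ∧ x < κ (i + 1) then 1 else 0
  | p + 1, i, x =>
      (x - κ i) / (κ (i + (p + 1)) - κ i) * bspline κ p i x +
        (κ (i + (p + 1) + 1) - x) / (κ (i + (p + 1) + 1) - κ (i + 1)) * bspline κ p (i + 1) x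

/-- `s 1, …, s m` is an open knot vector of degree `p` on `[0, 1]`:
`0 = s_1 = ⋯ = s_{p+1} < s_{p+2} ≤ ⋯ ≤ s_{m-p-1} < s_{m-p} = ⋯ = s_m = 1`. -/
structure IsOpenKnotVector (p m : ℕ) (s : ℕ → ℝ) : Prop where
  length : 2 * p + 2 ≤ m
  mono : ∀ i j, 1 ≤ i → i ≤ j → j ≤ m → s i ≤ s j
  first : ∀ i, 1 ≤ i → i ≤ p + 1 → s i = 0
  last : ∀ i, m - p ≤ i → i ≤ m → s i = 1
  first_lt : s (p + 1) < s (p + 2)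
  lt_last : s (m - p - 1) < s (m - p)

namespace TMesh

variable {m n : ℕ} (T : TMesh m n)

/-- The T-spline blending function of the anchor `A`: the product of the B-splines on the local
knot vectors of `A`. -/
def blending (p q : ℕ) (s t : ℕ → ℝ) (A : IndexRect) (x : ℝ × ℝ) : ℝ :=
  bspline (fun k => s (localIndex (T.hIndexSet A) p A.left k)) p 0 x.1 *
    bspline (fun k => t (localIndex (T.vIndexSet A) q A.bottom k)) q 0 x.2

end TMesh

/-- The parametric domain of the open index rectangle `R`. -/
def paramDomain (s t : ℕ → ℝ) (R : IndexRect) : Set (ℝ × ℝ) :=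
  Set.Ioo (s R.left) (s R.right) ×ˢ Set.Ioo (t R.bottom) (t R.top)

/-- A Bézier element: a cell of the extended T-mesh with positive parametric area. -/
def TMesh.IsBezierElement {m n : ℕ} (T : TMesh m n) (p q : ℕ) (s t : ℕ → ℝ) (R : IndexRect) :
    Prop :=
  T.IsExtCell p q R ∧ s R.left < s R.right ∧ t R.bottom < t R.top

/-- The anchors whose blending functions are not identically zero on the parametric domain of
`R`. -/
def TMesh.activeAnchors {m n : ℕ} (T : TMesh m n) (p q : ℕ) (s t : ℕ → ℝ) (R : IndexRect) :
    Set IndexRect :=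
  {A | T.IsAnchor p q A ∧ ∃ x ∈ paramDomain s t R, T.blending p q s t A x ≠ 0}

end TSpline

end

/-! ### Polynomial pieces of B-splines -/

noncomputable section
namespace TSpline
open Polynomial Finset

/-! Let a combination of the blending functions vanish on the element, and let `(u, u')` be a point
there at which `N_A` is nonzero. On a small box `[u, v) × [u', v')` without knots in its interior
ranges, every blending function is a product of two polynomials, one `hPiece` for each direction. By
`coeff_eq_zero_of_functionals`, the coefficient of `A` is zero once there are linear functionals
`L`, `M` on polynomials which are 1 on the two factors of `N_A` and such that, for every other
anchor `B`, at least one of them kills the corresponding factor of `N_B`.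

The functionals are dual functionals of univariate B-splines. Two overlapping index vectors are
sections of one knot sequence (`exists_common_knots`), and the B-splines on that sequence which are
active on a knot span are a basis of the polynomials of degree at most `p`; the coordinate of the
first B-spline is 1 on it and 0 on the second. By Marsden's identity this coordinate maps `(y - X) ^
p` to a product over the inner knots of the first B-spline only. On degree at most `p` it is
therefore independent of the second vector, so one functional serves all of them
(`exists_dual_functional`).

It remains to show that two different anchors have overlapping, different index vectors in some
direction (`hOverlap_or_vOverlap`). If the vertical vectors do not overlap, some horizontal line in
both vertical ranges spans exactly one of the two anchors, so it breaks off at a T-junction.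
Counting skeleton points shows that the extension of this T-junction covers the common horizontal
range, unless it meets a vertical line that an anchor's index vector misses (a `Defect`). Along a
horizontal extension, however, the skeleton and the index vector agree (`vPoint_iff_mem_hIndexSet`):
a disagreement yields either a crossing vertical extension, excluded by analysis-suitability, or a
defect in the other direction nearer to the anchor, and the descent terminates. So there are no
defects, and both horizontal vectors are read off the same line. -/

open Classical in
/-- The polynomial that coincides, immediately to the right of `u`, with the B-spline
`bspline κ p i`. -/
def bsplinePiece (κ : ℕ → ℝ) (u : ℝ) : ℕ → ℕ → ℝ[X]
  | 0, i => if κ i ≤ u ∧ u < κ (i + 1) then 1 else 0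
  | p + 1, i =>
      C (κ (i + (p + 1)) - κ i)⁻¹ * (X - C (κ i)) * bsplinePiece κ u p i +
        C (κ (i + (p + 1) + 1) - κ (i + 1))⁻¹ * (C (κ (i + (p + 1) + 1)) - X) *
          bsplinePiece κ u p (i + 1)

/-- With no knot strictly between `u` and `v`, the degree-zero indicators are constant on `[u, v)`,
and the recursion preserves agreement. -/
theorem bspline_eq_eval {κ : ℕ → ℝ} {u v : ℝ} (p i : ℕ)
    (h : ∀ k, i ≤ k → k ≤ i + p + 1 → κ k ≤ u ∨ v ≤ κ k) {x : ℝ} (hx : x ∈ Set.Ico u v) :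
    bspline κ p i x = (bsplinePiece κ u p i).eval x := by
  induction p generalizing i with
  | zero =>
    have h0 := h i le_rfl (by omega)
    have h1 := h (i + 1) (by omega) (by omega)
    have : (κ i ≤ x ∧ x < κ (i + 1)) ↔ (κ i ≤ u ∧ u < κ (i + 1)) := by
      obtain ⟨hx1, hx2⟩ := hx
      constructor
      · rintro ⟨ha, hb⟩
        refine ⟨?_, by linarith⟩
        rcases h0 with h0 | h0 <;> linarith
      · rintro ⟨ha, hb⟩
        refine ⟨by linarith, ?_⟩
        rcases h1 with h1 | h1 <;> linarith
    simp only [bspline, bsplinePiece, this]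
    split_ifs <;> simp
  | succ p ih =>
    simp only [bspline, bsplinePiece, eval_add, eval_mul, eval_C, eval_sub, eval_X]
    rw [ih i fun k h1 h2 => h k h1 (by omega),
      ih (i + 1) fun k h1 h2 => h k (by omega) (by omega)]
    ring

theorem bsplinePiece_congr {κ κ' : ℕ → ℝ} (u : ℝ) (p i i' : ℕ)
    (h : ∀ r ≤ p + 1, κ (i + r) = κ' (i' + r)) :
    bsplinePiece κ u p i = bsplinePiece κ' u p i' := by
  induction p generalizing i i' with
  | zero =>
    have h0 := h 0 (by omega)
    have h1 := h 1 (by omega)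
    simp only [add_zero] at h0
    simp only [bsplinePiece, h0, h1]
  | succ p ih =>
    have h0 := h 0 (by omega)
    simp only [add_zero] at h0
    simp only [bsplinePiece, ← add_assoc] at *
    rw [ih i i' fun r hr => h r (by omega),
      ih (i + 1) (i' + 1) fun r hr => by simpa [add_assoc, add_comm 1] using h (r + 1) (by omega)]
    have h1 := h 1 (by omega)
    have h2 := h (p + 1) (by omega)
    have h3 := h (p + 2) (by omega)
    simp only [← add_assoc] at h1 h2 h3
    rw [show i + p + 1 + 1 = i + p + 2 by ring, show i' + p + 1 + 1 = i' + p + 2 by ring,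
      h0, h1, h2, h3]

theorem bsplinePiece_degree (κ : ℕ → ℝ) (u : ℝ) (p i : ℕ) :
    bsplinePiece κ u p i ∈ degreeLT ℝ (p + 1) := by
  rw [degreeLT_succ_eq_degreeLE, mem_degreeLE]
  induction p generalizing i with
  | zero =>
    simp only [bsplinePiece]
    split_ifs
    · simp
    · simp
  | succ p ih =>
    have key (a b c : ℝ) (f : ℝ[X]) (hf : f.degree ≤ (p : WithBot ℕ)) :
        (C a * (C b * X + C c) * f).degree ≤ ((p + 1 : ℕ) : WithBot ℕ) := by
      rw [show ((p + 1 : ℕ) : WithBot ℕ) = (0 + 1) + p by push_cast; ring]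
      refine (degree_mul_le _ _).trans (add_le_add ?_ hf)
      exact (degree_mul_le _ _).trans (add_le_add degree_C_le degree_linear_le)
    simp only [bsplinePiece]
    refine (degree_add_le _ _).trans (max_le ?_ ?_)
    · have := key (κ (i + (p + 1)) - κ i)⁻¹ 1 (-κ i) _ (ih i)
      rwa [C_1, one_mul, C_neg, ← sub_eq_add_neg] at this
    · have := key (κ (i + (p + 1) + 1) - κ (i + 1))⁻¹ (-1) (κ (i + (p + 1) + 1)) _ (ih (i + 1))
      rwa [C_neg, C_1, neg_one_mul, neg_add_eq_sub] at this

theorem bsplinePiece_eq_zero {κ : ℕ → ℝ} (hκ : Monotone κ) {u : ℝ} (p i : ℕ)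
    (h : u < κ i ∨ κ (i + p + 1) ≤ u) : bsplinePiece κ u p i = 0 := by
  induction p generalizing i with
  | zero =>
    simp only [bsplinePiece]
    rw [if_neg]
    rcases h with h | h
    · exact fun h' => absurd h'.1 (not_le.2 h)
    · exact fun h' => absurd h'.2 (not_lt.2 h)
  | succ p ih =>
    simp only [bsplinePiece]
    rw [ih i, ih (i + 1)]
    · simp
    · rcases h with h | h
      · exact Or.inl (h.trans_le (hκ (by omega)))
      · exact Or.inr ((hκ (by omega)).trans h)
    · rcases h with h | h
      · exact Or.inl h
      · exact Or.inr ((hκ (by omega)).trans h)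

/-! ### Marsden's identity and dual functionals -/

/-- Marsden's identity. -/
theorem marsden_identity {κ : ℕ → ℝ} (hκ : Monotone κ) {u : ℝ} (y : ℝ) (p ν : ℕ)
    (h1 : κ (ν + p) ≤ u) (h2 : u < κ (ν + p + 1)) :
    ∑ l ∈ range (p + 1), C (∏ r ∈ range p, (y - κ (ν + l + r + 1))) * bsplinePiece κ u p (ν + l)
      = (C y - X) ^ p := by
  induction p generalizing ν with
  | zero =>
    simp only [add_zero] at h1 h2
    rw [zero_add, sum_range_one, add_zero, prod_range_zero, pow_zero, C_1, one_mul]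
    simp only [bsplinePiece, if_pos (show κ ν ≤ u ∧ u < κ (ν + 1) from ⟨h1, h2⟩)]
  | succ p ih =>
    have e1 : ν + 1 + p = ν + (p + 1) := by ring
    have IH := ih (ν + 1) (by rwa [e1]) (by rwa [e1])
    -- Splitting each piece by the recursion gives two sums shifted by one. Their unmatched end
    -- terms contain lower-degree pieces supported off the span of `u`, which vanish.
    have hz1 : bsplinePiece κ u p ν = 0 :=
      bsplinePiece_eq_zero hκ _ _ (Or.inr h1)
    have hz2 : bsplinePiece κ u p (ν + (p + 1) + 1) = 0 :=
      bsplinePiece_eq_zero hκ _ _ (Or.inl h2)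
    simp only [bsplinePiece, mul_add, sum_add_distrib]
    rw [sum_range_succ' _ (p + 1), sum_range_succ _ (p + 1)]
    simp only [add_zero, hz1, hz2, mul_zero, ← sum_add_distrib]
    rw [pow_succ, ← IH, sum_mul]
    refine sum_congr rfl fun l hl => ?_
    have hl' : l ≤ p := by simpa [Nat.lt_succ_iff] using hl
    have hlt : κ (ν + l + 1) < κ (ν + l + 1 + p + 1) :=
      (hκ (by omega)).trans_lt ((h1.trans_lt h2).trans_le (hκ (by omega)))
    -- The support contains the nonempty span of `u`, so the convention for zero quotients does not
    -- intervene here.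
    have hne : κ (ν + l + 1 + p + 1) - κ (ν + l + 1) ≠ 0 := by linarith
    have hp1 : ∏ r ∈ range (p + 1), (y - κ (ν + (l + 1) + r + 1)) =
        (∏ r ∈ range p, (y - κ (ν + l + 1 + r + 1))) * (y - κ (ν + l + 1 + p + 1)) := by
      rw [prod_range_succ]; simp only [← add_assoc]
    have hp2 : ∏ r ∈ range (p + 1), (y - κ (ν + l + r + 1)) =
        (∏ r ∈ range p, (y - κ (ν + l + 1 + r + 1))) * (y - κ (ν + l + 1)) := by
      rw [prod_range_succ']; simp only [← add_assoc, add_zero]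
      congr 1
      exact prod_congr rfl fun r _ => by rw [show ν + l + r + 1 + 1 = ν + l + 1 + r + 1 by ring]
    have hp3 : ∏ r ∈ range p, (y - κ (ν + 1 + l + r + 1)) =
        ∏ r ∈ range p, (y - κ (ν + l + 1 + r + 1)) :=
      prod_congr rfl fun r _ => by rw [show ν + 1 + l + r + 1 = ν + l + 1 + r + 1 by ring]
    rw [hp1, hp2, hp3]
    rw [show ν + (l + 1) + (p + 1) = ν + l + 1 + p + 1 by ring,
      show ν + l + (p + 1) + 1 = ν + l + 1 + p + 1 by ring,
      show ν + (l + 1) = ν + l + 1 by ring, show ν + 1 + l = ν + l + 1 by ring]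
    generalize bsplinePiece κ u p (ν + l + 1) = N
    generalize ∏ r ∈ range p, (y - κ (ν + l + 1 + r + 1)) = Q
    have hC : C (κ (ν + l + 1 + p + 1) - κ (ν + l + 1))⁻¹ *
        (C (κ (ν + l + 1 + p + 1)) - C (κ (ν + l + 1))) = 1 := by
      rw [← C_sub, ← C_mul, inv_mul_cancel₀ hne, C_1]
    simp only [C_mul, C_sub]
    linear_combination (C Q * N * (C y - X)) * hC

/-- A linear functional on polynomials of degree at most `p` is determined by its values on the
powers `(y - X) ^ p`. -/
theorem functional_ext (p : ℕ) (L L' : ℝ[X] →ₗ[ℝ] ℝ)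
    (h : ∀ y : ℝ, L ((C y - X) ^ p) = L' ((C y - X) ^ p)) {f : ℝ[X]}
    (hf : f ∈ degreeLT ℝ (p + 1)) : L f = L' f := by
  suffices H : ∀ M : ℝ[X] →ₗ[ℝ] ℝ, (∀ y : ℝ, M ((C y - X) ^ p) = 0) → M f = 0 by
    have := H (L - L') fun y => by simp [h]
    simpa [sub_eq_zero] using this
  intro M hM
  have hX : ∀ r ≤ p, M (X ^ r) = 0 := by
    -- This is `M ((y - X) ^ p)` expanded as a polynomial in `y`. It vanishes identically, and its
    -- coefficients are nonzero multiples of the moments `M (X ^ r)`.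
    let g : ℝ[X] := ∑ r ∈ range (p + 1), C ((-1) ^ r * (p.choose r : ℝ) * M (X ^ r)) * X ^ (p - r)
    have hg : g = 0 := by
      refine Polynomial.funext fun y => ?_
      rw [eval_zero, ← hM y, sub_eq_neg_add, add_pow, map_sum, eval_finsetSum]
      refine sum_congr rfl fun r _ => ?_
      have : (-X : ℝ[X]) ^ r * C y ^ (p - r) * (p.choose r : ℝ[X]) =
          ((-1) ^ r * (p.choose r : ℝ) * y ^ (p - r)) • X ^ r := by
        rw [smul_eq_C_mul]
        simp only [C_mul, C_pow, C_neg, C_1, map_natCast, neg_pow (X : ℝ[X])]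
        ring
      rw [this, map_smul]
      simp only [eval_mul, eval_C, eval_pow, eval_X, smul_eq_mul]
      ring
    intro r hr
    have hc := congrArg (fun f => coeff f (p - r)) hg
    simp only [g, finsetSum_coeff, coeff_C_mul, coeff_X_pow, coeff_zero] at hc
    rw [sum_eq_single r] at hc
    · have : (p.choose r : ℝ) ≠ 0 := by exact_mod_cast (Nat.choose_pos hr).ne'
      simpa [this] using hc
    · intro b hb hbr
      rw [if_neg, mul_zero]
      have := mem_range.1 hb
      omega
    · intro hr'
      exact absurd (mem_range.2 (by omega)) hr'
  rw [f.as_sum_range' (p + 1) ?_, map_sum]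
  · refine sum_eq_zero fun r hr => ?_
    rw [← C_mul_X_pow_eq_monomial, ← smul_eq_C_mul, map_smul,
      hX r (by simpa [Nat.lt_succ_iff] using hr), smul_zero]
  · have := mem_degreeLT.1 hf
    by_cases hf0 : f = 0
    · simp [hf0]
    · exact (natDegree_lt_iff_degree_lt hf0).2 this

/-- The dual functional of a B-spline that belongs to the basis on a knot span. -/
theorem exists_functional {κ : ℕ → ℝ} (hκ : Monotone κ) {u : ℝ} (p ν k : ℕ)
    (h1 : κ (ν + p) ≤ u) (h2 : u < κ (ν + p + 1)) (hk : ν ≤ k) (hk' : k ≤ ν + p) :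
    ∃ L : ℝ[X] →ₗ[ℝ] ℝ,
      (∀ y : ℝ, L ((C y - X) ^ p) = ∏ r ∈ range p, (y - κ (k + r + 1))) ∧
      ∀ i, L (bsplinePiece κ u p i) = if i = k then 1 else 0 := by
  let b : Fin (p + 1) → ℝ[X] := fun l => bsplinePiece κ u p (ν + l)
  have hspan : Submodule.span ℝ (Set.range b) = degreeLT ℝ (p + 1) := by
    refine le_antisymm (Submodule.span_le.2 ?_) ?_
    · rintro _ ⟨l, rfl⟩
      exact bsplinePiece_degree _ _ _ _
    · intro f hf
      -- A polynomial outside the span would be detected by a functional that kills the span; by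
      -- Marsden's identity that functional kills every `(y - X) ^ p`, hence all polynomials of
      -- degree at most `p`.
      by_contra hfn
      obtain ⟨M, hM, hM'⟩ := Submodule.exists_dual_map_eq_bot_of_notMem hfn inferInstance
      refine hM (functional_ext p M 0 (fun y => ?_) hf)
      have hb : ∀ l : ℕ, l < p + 1 → M (bsplinePiece κ u p (ν + l)) = 0 := fun l hl => by
        have : M (b ⟨l, hl⟩) ∈ (Submodule.span ℝ (Set.range b)).map M :=
          Submodule.mem_map_of_mem (Submodule.subset_span ⟨_, rfl⟩)
        rwa [hM', Submodule.mem_bot] at this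
      rw [← marsden_identity hκ y p ν h1 h2, map_sum]
      refine sum_eq_zero fun l hl => ?_
      rw [← smul_eq_C_mul, map_smul, hb l (mem_range.1 hl), smul_zero]
  -- The `p + 1` pieces span a space of dimension `p + 1`.
  have hli : LinearIndependent ℝ b := by
    rw [linearIndependent_iff_card_eq_finrank_span, Set.finrank, hspan]
    rw [(degreeLTEquiv ℝ (p + 1)).finrank_eq]
    simp
  obtain ⟨l, rfl⟩ := Nat.exists_eq_add_of_le hk
  let l' : Fin (p + 1) := ⟨l, by omega⟩
  -- Extending to a basis of all of `ℝ[X]` makes the coordinate a functional on the whole space; its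
  -- values in higher degrees play no role.
  let B := Module.Basis.extend hli.linearIndepOn_id
  have hmem : ∀ j, b j ∈ hli.linearIndepOn_id.extend (Set.subset_univ _) := fun j =>
    hli.linearIndepOn_id.subset_extend _ ⟨j, rfl⟩
  have hcoord : ∀ j, B.coord ⟨b l', hmem l'⟩ (b j) = if j = l' then 1 else 0 := by
    intro j
    have : b j = B ⟨b j, hmem j⟩ := by simp [B]
    rw [this, Module.Basis.coord_apply, Module.Basis.repr_self, Finsupp.single_apply]
    simp [hli.injective.eq_iff]
  have hcoord' : ∀ j, j < p + 1 → B.coord ⟨b l', hmem l'⟩ (bsplinePiece κ u p (ν + j)) =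
      if j = l then 1 else 0 := fun j hj => by
    have := hcoord ⟨j, hj⟩
    simpa [b, l'] using this
  refine ⟨B.coord ⟨b l', hmem l'⟩, fun y => ?_, fun i => ?_⟩
  · rw [← marsden_identity hκ y p ν h1 h2, map_sum, sum_eq_single l]
    · rw [← smul_eq_C_mul, map_smul, hcoord' l (by omega), if_pos rfl, smul_eq_mul, mul_one]
    · intro j hj hjl
      rw [← smul_eq_C_mul, map_smul, hcoord' j (mem_range.1 hj), if_neg hjl, smul_zero]
    · intro h
      exact absurd (mem_range.2 (by omega)) h
  · by_cases hi : ν ≤ i ∧ i ≤ ν + p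
    · obtain ⟨j, rfl⟩ := Nat.exists_eq_add_of_le hi.1
      rw [hcoord' j (by omega)]
      simp
    · rw [bsplinePiece_eq_zero hκ, map_zero, if_neg (by omega)]
      rcases lt_or_ge i ν with h | h
      · exact Or.inr ((hκ (by omega)).trans h1)
      · exact Or.inl (h2.trans_le (hκ (by omega)))

/-! ### Overlapping index vectors -/

/-- Two index vectors agree on the intersection of the index ranges which they span. -/
def Overlap (p : ℕ) (α β : ℕ → ℕ) : Prop :=
  ∀ z, α 0 ≤ z → z ≤ α (p + 1) → β 0 ≤ z → z ≤ β (p + 1) →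
    ((∃ k ≤ p + 1, α k = z) ↔ ∃ k ≤ p + 1, β k = z)

/-- Since `Z` has no elements between successive entries of `α`, counting elements of `Z` below `α
k` increases by one with `k`. The offset is the count below `α 0`. -/
theorem nth_eq_of_consecutive {Z : Set ℕ} {p : ℕ} {α : ℕ → ℕ}
    (hα : ∀ k ≤ p, α k < α (k + 1))
    (hZ : ∀ z, α 0 ≤ z → z ≤ α (p + 1) → (z ∈ Z ↔ ∃ k ≤ p + 1, α k = z)) :
    ∃ c, ∀ k ≤ p + 1, Nat.nth (· ∈ Z) (c + k) = α k := by
  classical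
  have hmono : ∀ k, k ≤ p + 1 → ∀ j ≤ k, α j ≤ α k := by
    intro k
    induction k with
    | zero => intro _ j hj; rw [Nat.le_zero.1 hj]
    | succ k ih =>
      intro hk j hj
      rcases Nat.lt_or_ge j (k + 1) with h | h
      · exact (ih (by omega) j (by omega)).trans (hα k (by omega)).le
      · rw [le_antisymm hj h]
  have hmem : ∀ k ≤ p + 1, α k ∈ Z := fun k hk =>
    (hZ _ (hmono k hk 0 (by omega)) (hmono _ le_rfl k hk)).2 ⟨k, hk, rfl⟩
  have hcount : ∀ k ≤ p + 1, Nat.count (· ∈ Z) (α k) = Nat.count (· ∈ Z) (α 0) + k := by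
    intro k
    induction k with
    | zero => simp
    | succ k ih =>
      intro hk
      have h1 : Nat.count (· ∈ Z) (α (k + 1)) = Nat.count (· ∈ Z) (α k + 1) := by
        have hle : α k + 1 ≤ α (k + 1) := hα k (by omega)
        obtain ⟨d, hd⟩ := Nat.exists_eq_add_of_le hle
        rw [hd, Nat.count_add, Nat.add_eq_left, Nat.count_iff_forall_not]
        intro x hx hxZ
        obtain ⟨j, hj, hjx⟩ := (hZ _ ((hmono k (by omega) 0 (by omega)).trans (by omega))
          (le_trans (by omega) (hmono _ le_rfl (k + 1) hk))).1 hxZ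
        rcases Nat.lt_or_ge k j with h | h
        · have := hmono j hj (k + 1) h
          omega
        · have := hmono k (by omega) j h
          omega
      rw [h1, Nat.count_succ, ih (by omega), if_pos (hmem k (by omega))]
      ring
  refine ⟨Nat.count (· ∈ Z) (α 0), fun k hk => ?_⟩
  rw [← hcount k hk]
  exact Nat.nth_count (p := (· ∈ Z)) (hmem k hk)

/-- Overlapping index vectors are sections of a common knot sequence. -/
theorem exists_common_knots {s : ℕ → ℝ} (hs : Monotone s) {p : ℕ} {α β : ℕ → ℕ}
    (hα : ∀ k ≤ p, α k < α (k + 1)) (hβ : ∀ k ≤ p, β k < β (k + 1)) (h : Overlap p α β) :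
    ∃ (κ : ℕ → ℝ) (a b : ℕ), Monotone κ ∧ p ≤ a ∧
      (∀ k ≤ p + 1, κ (a + k) = s (α k)) ∧ (∀ k ≤ p + 1, κ (b + k) = s (β k)) ∧
      (a = b → ∀ k ≤ p + 1, α k = β k) := by
  -- The indices beyond both vectors make `Z` infinite, so that `Nat.nth` is strictly monotone and
  -- never takes its default value.
  let Z : Set ℕ := {z | (∃ k ≤ p + 1, α k = z) ∨ (∃ k ≤ p + 1, β k = z) ∨
    (α (p + 1) < z ∧ β (p + 1) < z)}
  have hinc : ∀ γ : ℕ → ℕ, (∀ k ≤ p, γ k < γ (k + 1)) → ∀ k ≤ p + 1, γ 0 ≤ γ k ∧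
      γ k ≤ γ (p + 1) := by
    intro γ hγ k hk
    constructor
    · induction k with
      | zero => rfl
      | succ k ih => exact (ih (by omega)).trans (hγ k (by omega)).le
    · induction hk using Nat.decreasingInduction with
      | self => rfl
      | of_succ k hk ih => exact (hγ k (by omega)).le.trans ih
  have hZinf : Z.Infinite := by
    refine Set.infinite_of_not_bddAbove ?_
    rintro ⟨M, hM⟩
    have : M + α (p + 1) + β (p + 1) + 1 ≤ M :=
      hM (show _ ∈ Z from Or.inr (Or.inr ⟨by omega, by omega⟩))
    omega
  obtain ⟨a, ha⟩ := nth_eq_of_consecutive (Z := Z) hα fun z h0 h1 => by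
    refine ⟨?_, fun h => Or.inl h⟩
    rintro (h2 | ⟨k, hk, rfl⟩ | h2)
    · exact h2
    · exact (h _ h0 h1 (hinc β hβ k hk).1 (hinc β hβ k hk).2).2 ⟨k, hk, rfl⟩
    · omega
  obtain ⟨b, hb⟩ := nth_eq_of_consecutive (Z := Z) hβ fun z h0 h1 => by
    refine ⟨?_, fun h => Or.inr (Or.inl h)⟩
    rintro (⟨k, hk, rfl⟩ | h2 | h2)
    · exact (h _ (hinc α hα k hk).1 (hinc α hα k hk).2 h0 h1).1 ⟨k, hk, rfl⟩
    · exact h2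
    · omega
  -- The truncated subtraction prepends `p` copies of the first knot. Every span starting at or
  -- after `p + a` then has a full set of `p + 1` active B-splines.
  refine ⟨fun k => s (Nat.nth (· ∈ Z) (k - p)), p + a, p + b, ?_, by omega, ?_, ?_, ?_⟩
  · exact hs.comp ((Nat.nth_strictMono hZinf).monotone.comp fun x y hxy => by
      simpa using Nat.sub_le_sub_right hxy p)
  · intro k hk
    simp only [show p + a + k - p = a + k by omega, ha k hk]
  · intro k hk
    simp only [show p + b + k - p = b + k by omega, hb k hk]
  · intro hab k hk
    rw [← ha k hk, ← hb k hk, show a = b by omega]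

/-- The B-spline with index vector `α` has a dual functional on a span where it does not vanish,
and this functional annihilates all B-splines with an overlapping index vector different
from `α`. -/
theorem exists_dual_functional {s : ℕ → ℝ} (hs : Monotone s) {p : ℕ} {α : ℕ → ℕ}
    (hα : ∀ k ≤ p, α k < α (k + 1)) {u : ℝ}
    (hu : bsplinePiece (fun k => s (α k)) u p 0 ≠ 0) :
    ∃ L : ℝ[X] →ₗ[ℝ] ℝ, L (bsplinePiece (fun k => s (α k)) u p 0) = 1 ∧
      ∀ β : ℕ → ℕ, (∀ k ≤ p, β k < β (k + 1)) → Overlap p α β →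
        (∃ k ≤ p + 1, α k ≠ β k) → L (bsplinePiece (fun k => s (β k)) u p 0) = 0 := by
  have key : ∀ β : ℕ → ℕ, (∀ k ≤ p, β k < β (k + 1)) → Overlap p α β →
      ∃ L : ℝ[X] →ₗ[ℝ] ℝ,
        (∀ y : ℝ, L ((C y - X) ^ p) = ∏ r ∈ range p, (y - s (α (r + 1)))) ∧
        L (bsplinePiece (fun k => s (α k)) u p 0) = 1 ∧
        ((∃ k ≤ p + 1, α k ≠ β k) → L (bsplinePiece (fun k => s (β k)) u p 0) = 0) := by
    intro β hβ h
    obtain ⟨κ, a, b, hκ, hpa, ha, hb, hab⟩ := exists_common_knots hs hα hβ h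
    have hpa' : bsplinePiece (fun k => s (α k)) u p 0 = bsplinePiece κ u p a :=
      bsplinePiece_congr u p 0 a fun r hr => by simp [ha r hr]
    have hpb' : bsplinePiece (fun k => s (β k)) u p 0 = bsplinePiece κ u p b :=
      bsplinePiece_congr u p 0 b fun r hr => by simp [hb r hr]
    have h1 : κ a ≤ u := by
      by_contra hcon
      exact hu (hpa' ▸ bsplinePiece_eq_zero hκ p a (Or.inl (not_le.1 hcon)))
    have h2 : u < κ (a + p + 1) := by
      by_contra hcon
      exact hu (hpa' ▸ bsplinePiece_eq_zero hκ p a (Or.inr (not_lt.1 hcon)))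
    classical
    -- The span of the common sequence that contains `u` begins at `a + d`.
    let d := Nat.find (⟨p, h2⟩ : ∃ d, u < κ (a + d + 1))
    have hd : u < κ (a + d + 1) := Nat.find_spec (⟨p, h2⟩ : ∃ d, u < κ (a + d + 1))
    have hdp : d ≤ p := Nat.find_min' _ h2
    have hd' : κ (a + d) ≤ u := by
      rcases Nat.eq_zero_or_pos d with h0 | h0
      · rwa [h0]
      · have := Nat.find_min (⟨p, h2⟩ : ∃ d, u < κ (a + d + 1)) (m := d - 1) (by omega)
        rw [not_lt, show a + (d - 1) + 1 = a + d by omega] at this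
        exact this
    have e : a + d - p + p = a + d := by omega
    obtain ⟨L, hL1, hL2⟩ := exists_functional hκ (u := u) p (a + d - p) a (by rwa [e]) (by rwa [e])
      (by omega) (by omega)
    refine ⟨L, fun y => ?_, ?_, fun hne => ?_⟩
    · rw [hL1]
      refine prod_congr rfl fun r hr => ?_
      rw [add_assoc, ha (r + 1) (by have := mem_range.1 hr; omega)]
    · rw [hpa', hL2, if_pos rfl]
    · rw [hpb', hL2, if_neg]
      rintro rfl
      obtain ⟨k, hk, hk'⟩ := hne
      exact hk' (hab rfl k hk)
  -- The functional is fixed before `β` is chosen. The one produced for a given `β` has the same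
  -- values on `(y - X) ^ p`, hence agrees with it up to degree `p`.
  obtain ⟨L, hL, hL1, -⟩ := key α hα fun z _ _ _ _ => Iff.rfl
  refine ⟨L, hL1, fun β hβ h hne => ?_⟩
  obtain ⟨M, hM, -, hM0⟩ := key β hβ h
  rw [← hM0 hne]
  exact functional_ext p L M (fun y => by rw [hL, hM]) (bsplinePiece_degree _ _ _ _)

end TSpline
end

noncomputable section
namespace TSpline

/-! ### Counting mesh indices -/

/-- The number of elements of `S` strictly between `a` and `b`. -/
def gapCount (S : Set ℕ) (a b : ℕ) : ℕ := (S ∩ Set.Ioo a b).ncard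

theorem finite_inter_Ioo (S : Set ℕ) (a b : ℕ) : (S ∩ Set.Ioo a b).Finite :=
  (Set.finite_Ioo a b).subset Set.inter_subset_right

theorem gapCount_mono {S S' : Set ℕ} {a b a' b' : ℕ} (ha : a' ≤ a) (hb : b ≤ b')
    (h : ∀ x ∈ S, a < x → x < b → x ∈ S') : gapCount S a b ≤ gapCount S' a' b' :=
  Set.ncard_le_ncard (fun x hx => ⟨h x hx.1 hx.2.1 hx.2.2, ha.trans_lt hx.2.1, hx.2.2.trans_le hb⟩)
    (finite_inter_Ioo _ _ _)

theorem gapCount_lt {S S' : Set ℕ} {a b a' b' y : ℕ} (ha : a' ≤ a) (hb : b ≤ b')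
    (h : ∀ x ∈ S, a < x → x < b → x ∈ S') (hy : y ∈ S') (hy1 : a' < y) (hy2 : y < b')
    (hy3 : y ≤ a ∨ b ≤ y) : gapCount S a b < gapCount S' a' b' := by
  refine Set.ncard_lt_ncard ?_ (finite_inter_Ioo _ _ _)
  have hsub : S ∩ Set.Ioo a b ⊆ S' ∩ Set.Ioo a' b' := fun x hx =>
    ⟨h x hx.1 hx.2.1 hx.2.2, ha.trans_lt hx.2.1, hx.2.2.trans_le hb⟩
  refine (Set.ssubset_iff_of_subset hsub).2 ⟨y, ⟨hy, hy1, hy2⟩, ?_⟩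
  rintro ⟨-, h1, h2⟩
  omega

theorem gapCount_le_add_one {S : Set ℕ} {a b a' b' y : ℕ}
    (h : ∀ x ∈ S, a < x → x < b → x = y ∨ (a' < x ∧ x < b')) :
    gapCount S a b ≤ gapCount S a' b' + 1 := by
  refine (Set.ncard_le_ncard (t := insert y (S ∩ Set.Ioo a' b')) ?_
    ((finite_inter_Ioo _ _ _).insert _)).trans (Set.ncard_insert_le _ _)
  intro x hx
  rcases h x hx.1 hx.2.1 hx.2.2 with rfl | h
  · exact Or.inl rfl
  · exact Or.inr ⟨hx.1, h⟩

theorem gapCount_pos {S : Set ℕ} {a b : ℕ} (h : 0 < gapCount S a b) :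
    ∃ x ∈ S, a < x ∧ x < b := by
  obtain ⟨x, hx⟩ := Set.nonempty_of_ncard_ne_zero h.ne'
  exact ⟨x, hx.1, hx.2.1, hx.2.2⟩

theorem le_gapCount {S : Set ℕ} {a b l r : ℕ} (h : ∀ x, a ≤ x → x ≤ b → x ∈ S) (hl : l < a)
    (hr : b < r) : b + 1 - a ≤ gapCount S l r := by
  have : ((Finset.Icc a b : Finset ℕ) : Set ℕ).ncard ≤ gapCount S l r := by
    refine Set.ncard_le_ncard (fun x hx => ?_) (finite_inter_Ioo _ _ _)
    rw [Finset.mem_coe, Finset.mem_Icc] at hx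
    exact ⟨h x hx.1 hx.2, by omega, by omega⟩
  rwa [Set.ncard_coe_finset, Nat.card_Icc] at this

theorem nextIndex_spec {S : Set ℕ} {i x : ℕ} (hx : x ∈ S) (hix : i < x) :
    nextIndex S i ∈ S ∧ i < nextIndex S i ∧ nextIndex S i ≤ x :=
  have h : nextIndex S i ∈ {x | x ∈ S ∧ i < x} := Nat.sInf_mem ⟨x, hx, hix⟩
  ⟨h.1, h.2, Nat.sInf_le (show x ∈ {x | x ∈ S ∧ i < x} from ⟨hx, hix⟩)⟩

theorem bddAbove_lt (S : Set ℕ) (i : ℕ) : BddAbove {x | x ∈ S ∧ x < i} :=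
  ⟨i, fun _ h => h.2.le⟩

theorem prevIndex_spec {S : Set ℕ} {i x : ℕ} (hx : x ∈ S) (hix : x < i) :
    prevIndex S i ∈ S ∧ prevIndex S i < i ∧ x ≤ prevIndex S i :=
  have h : prevIndex S i ∈ {x | x ∈ S ∧ x < i} := Nat.sSup_mem ⟨x, hx, hix⟩ (bddAbove_lt S i)
  ⟨h.1, h.2, le_csSup (bddAbove_lt S i) (show x ∈ {x | x ∈ S ∧ x < i} from ⟨hx, hix⟩)⟩

theorem prevIndex_le (S : Set ℕ) (i : ℕ) : prevIndex S i ≤ i := by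
  rcases Set.eq_empty_or_nonempty {x | x ∈ S ∧ x < i} with h | ⟨x, hx⟩
  · simp [prevIndex, h]
  · exact (prevIndex_spec hx.1 hx.2).2.1.le

theorem prevIndex_iterate_le (S : Set ℕ) (k i : ℕ) : (prevIndex S)^[k] i ≤ i := by
  induction k with
  | zero => rfl
  | succ k ih =>
    rw [Function.iterate_succ_apply']
    exact (prevIndex_le _ _).trans ih

/-- The supply of `k` elements above `i` is needed because `nextIndex` falls back to 0 when it runs
out. For `prevIndex` the same fallback is harmless, being a lower bound anyway. -/
theorem le_nextIndex_iterate {S : Set ℕ} {M : ℕ} (k : ℕ) {i z : ℕ} (hiz : i ≤ z)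
    (hz : z = i ∨ gapCount S i z < k) (hk : k ≤ gapCount S i M) :
    z ≤ (nextIndex S)^[k] i := by
  induction k generalizing i z with
  | zero => simp at hz; simp [hz]
  | succ k ih =>
    rw [Function.iterate_succ_apply]
    obtain ⟨x, hx, hix, hxM⟩ := gapCount_pos (by omega : 0 < gapCount S i M)
    obtain ⟨h1, h2, h3⟩ := nextIndex_spec hx hix
    have hk' : k ≤ gapCount S (nextIndex S i) M := by
      have := gapCount_le_add_one (S := S) (a := i) (b := M) (a' := nextIndex S i) (b' := M)
        (y := nextIndex S i) fun x hx h h' => by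
          rcases (nextIndex_spec hx h).2.2.eq_or_lt with h'' | h''
          · exact Or.inl h''.symm
          · exact Or.inr ⟨h'', h'⟩
      omega
    rcases le_or_gt z (nextIndex S i) with h | h
    · exact h.trans (ih le_rfl (Or.inl rfl) hk')
    · refine ih h.le (Or.inr ?_) hk'
      have := gapCount_lt (S := S) (S' := S) (a := nextIndex S i) (b := z) (a' := i) (b' := z)
        h2.le le_rfl (fun x hx _ _ => hx) h1 h2 h (Or.inl le_rfl)
      omega

theorem gapCount_lt_of_le_nextIndex_iterate {S : Set ℕ} (k : ℕ) {i z : ℕ} (hiz : i < z)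
    (hz : z ≤ (nextIndex S)^[k] i) : gapCount S i z < k := by
  induction k generalizing i with
  | zero => exact absurd hz (by simpa using hiz)
  | succ k ih =>
    rw [Function.iterate_succ_apply] at hz
    by_contra hcon
    obtain ⟨x, hx, hix, hxz⟩ := gapCount_pos (by omega : 0 < gapCount S i z)
    obtain ⟨h1, h2, h3⟩ := nextIndex_spec hx hix
    have := ih (by omega) hz
    have := gapCount_le_add_one (S := S) (a := i) (b := z) (a' := nextIndex S i) (b' := z)
        (y := nextIndex S i) fun x hx h h' => by
          rcases (nextIndex_spec hx h).2.2.eq_or_lt with h'' | h''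
          · exact Or.inl h''.symm
          · exact Or.inr ⟨h'', h'⟩
    omega

theorem prevIndex_iterate_le_of {S : Set ℕ} (k : ℕ) {i z : ℕ} (hiz : z ≤ i)
    (hz : z = i ∨ gapCount S z i < k) : (prevIndex S)^[k] i ≤ z := by
  induction k generalizing i with
  | zero => simp at hz; simp [hz]
  | succ k ih =>
    rw [Function.iterate_succ_apply]
    rcases le_or_gt (prevIndex S i) z with h | h
    · exact (prevIndex_iterate_le _ _ _).trans h
    · have hne : {x | x ∈ S ∧ x < i}.Nonempty := by
        by_contra hcon
        rw [Set.not_nonempty_iff_eq_empty] at hcon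
        simp [prevIndex, hcon] at h
      obtain ⟨x, hx, hxi⟩ := hne
      obtain ⟨h1, h2, -⟩ := prevIndex_spec hx hxi
      refine ih h.le (Or.inr ?_)
      have := gapCount_lt (S := S) (S' := S) (a := z) (b := prevIndex S i) (a' := z) (b' := i)
        le_rfl h2.le (fun x hx _ _ => hx) h1 h h2 (Or.inr le_rfl)
      omega

theorem gapCount_lt_of_prevIndex_iterate_le {S : Set ℕ} (k : ℕ) {i z : ℕ} (hiz : z < i)
    (hz : (prevIndex S)^[k] i ≤ z) : gapCount S z i < k := by
  induction k generalizing i with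
  | zero => exact absurd hz (by simpa using hiz)
  | succ k ih =>
    rw [Function.iterate_succ_apply] at hz
    by_contra hcon
    obtain ⟨x, hx, hzx, hxi⟩ := gapCount_pos (by omega : 0 < gapCount S z i)
    obtain ⟨h1, h2, h3⟩ := prevIndex_spec hx hxi
    have := ih (by omega) hz
    have := gapCount_le_add_one (S := S) (a := z) (b := i) (a' := z) (b' := prevIndex S i)
        (y := prevIndex S i) fun x hx h h' => by
          rcases (prevIndex_spec hx h').2.2.eq_or_lt with h'' | h''
          · exact Or.inl h''
          · exact Or.inr ⟨h, h''⟩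
    omega

/-- `i` lies in the range of an index vector over `S` that takes `k` elements of `S` beyond each
end of `[l, r]`. -/
def InHull (S : Set ℕ) (k l r i : ℕ) : Prop :=
  (i ≤ r ∨ gapCount S r i < k) ∧ (l ≤ i ∨ gapCount S i l < k)

theorem InHull.of_between {S : Set ℕ} {k l r i y : ℕ} (h : InHull S k l r i)
    (hy : (l < y ∧ y < i) ∨ (i < y ∧ y < r)) : InHull S k l r y := by
  rcases hy with ⟨h1, h2⟩ | ⟨h1, h2⟩
  · refine ⟨?_, Or.inl h1.le⟩
    rcases h.1 with h | h
    · exact Or.inl (by omega)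
    · exact Or.inr ((gapCount_mono le_rfl h2.le fun x hx _ _ => hx).trans_lt h)
  · refine ⟨Or.inl h2.le, ?_⟩
    rcases h.2 with h | h
    · exact Or.inl (by omega)
    · exact Or.inr ((gapCount_mono h1.le le_rfl fun x hx _ _ => hx).trans_lt h)

/-- Pigeonhole: some element of `S` in the gap is missing from `S'`. All elements of `S` before the
first such one lie in `S'`, so there are at most `c - 1` of them, few enough for an extension to
reach it. -/
theorem exists_first_not_mem {S S' : Set ℕ} {a b c d : ℕ} (h : gapCount S' a b < c)
    (h' : c ≤ gapCount S a b) (hd : c ≤ d + 1) :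
    ∃ y ∈ S, y ∉ S' ∧ a < y ∧ y < b ∧ gapCount S a y ≤ d ∧
      ∀ x ∈ S, a < x → x < y → x ∈ S' := by
  have hex : ∃ y, y ∈ S ∧ y ∉ S' ∧ a < y ∧ y < b := by
    by_contra! hcon
    have := gapCount_mono (S := S) (S' := S') (le_refl a) (le_refl b) fun x hx h1 h2 => by
      by_contra hx'
      have := hcon x hx hx' h1
      omega
    omega
  classical
  obtain ⟨h1, h2, h3, h4⟩ := Nat.find_spec hex
  have hmin : ∀ x ∈ S, a < x → x < Nat.find hex → x ∈ S' := fun x hx hax hxy => by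
    by_contra hx'
    exact Nat.find_min hex hxy ⟨hx, hx', hax, by omega⟩
  have := gapCount_mono (S := S) (S' := S') (le_refl a) h4.le hmin
  exact ⟨_, h1, h2, h3, h4, by omega, hmin⟩

theorem exists_last_not_mem {S S' : Set ℕ} {a b c d : ℕ} (h : gapCount S' a b < c)
    (h' : c ≤ gapCount S a b) (hd : c ≤ d + 1) :
    ∃ y ∈ S, y ∉ S' ∧ a < y ∧ y < b ∧ gapCount S y b ≤ d ∧
      ∀ x ∈ S, y < x → x < b → x ∈ S' := by
  have hex : ∃ y, y ∈ S ∧ y ∉ S' ∧ a < y ∧ y < b := by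
    by_contra! hcon
    have := gapCount_mono (S := S) (S' := S') (le_refl a) (le_refl b) fun x hx h1 h2 => by
      by_contra hx'
      have := hcon x hx hx' h1
      omega
    omega
  obtain ⟨y, ⟨h1, h2, h3, h4⟩, hmax⟩ := ((Set.finite_Iio b).subset
    (fun y (hy : y ∈ {y | y ∈ S ∧ y ∉ S' ∧ a < y ∧ y < b}) => hy.2.2.2)).exists_maximal hex
  have hmax' : ∀ x ∈ S, y < x → x < b → x ∈ S' := fun x hx hyx hxb => by
    by_contra hx'
    have := hmax ⟨hx, hx', by omega, hxb⟩ hyx.le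
    omega
  have := gapCount_mono (S := S) (S' := S') h3.le (le_refl b) hmax'
  exact ⟨y, h1, h2, h3, h4, by omega, hmax'⟩

/-! ### The transposed mesh -/

/-- Reflection of a rectangle in the diagonal. -/
def IndexRect.transpose (R : IndexRect) : IndexRect := ⟨R.bottom, R.top, R.left, R.right⟩

namespace TMesh

/-- Reflection of a T-mesh in the diagonal. -/
def transpose {m n : ℕ} (T : TMesh m n) : TMesh n m where
  cells := {C | C.transpose ∈ T.cells}
  cell_horizontal C hC := T.cell_vertical _ hC
  cell_vertical C hC := T.cell_horizontal _ hC
  partition i j hi hi' hj hj' := by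
    obtain ⟨C, ⟨h1, h2, h3⟩, h4⟩ := T.partition j i hj hj' hi hi'
    refine ⟨C.transpose, ⟨h1, h3, h2⟩, fun D hD => ?_⟩
    rw [← h4 D.transpose ⟨hD.1, hD.2.2, hD.2.1⟩]
    rfl

variable {m n : ℕ} {T : TMesh m n}

theorem transpose_hSeg {i j : ℕ} : T.transpose.HSeg i j ↔ T.VSeg j i :=
  ⟨fun ⟨C, h⟩ => ⟨C.transpose, h⟩, fun ⟨C, h⟩ => ⟨C.transpose, h⟩⟩

theorem transpose_vSeg {i j : ℕ} : T.transpose.VSeg i j ↔ T.HSeg j i :=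
  ⟨fun ⟨C, h⟩ => ⟨C.transpose, h⟩, fun ⟨C, h⟩ => ⟨C.transpose, h⟩⟩

theorem transpose_hPoint {i j : ℕ} : T.transpose.HPoint i j ↔ T.VPoint j i :=
  ⟨fun ⟨C, h⟩ => ⟨C.transpose, h⟩, fun ⟨C, h⟩ => ⟨C.transpose, h⟩⟩

theorem transpose_vPoint {i j : ℕ} : T.transpose.VPoint i j ↔ T.HPoint j i :=
  ⟨fun ⟨C, h⟩ => ⟨C.transpose, h⟩, fun ⟨C, h⟩ => ⟨C.transpose, h⟩⟩

theorem transpose_isVertex {i j : ℕ} : T.transpose.IsVertex i j ↔ T.IsVertex j i :=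
  ⟨fun ⟨C, h, h1, h2⟩ => ⟨C.transpose, h, h2, h1⟩, fun ⟨C, h, h1, h2⟩ => ⟨C.transpose, h, h2, h1⟩⟩

theorem transpose_isInteriorVertex {i j : ℕ} :
    T.transpose.IsInteriorVertex i j ↔ T.IsInteriorVertex j i := by
  simp only [IsInteriorVertex, transpose_isVertex]
  tauto

theorem transpose_hSpan {j a b : ℕ} : T.transpose.HSpan j a b ↔ T.VSpan j a b := by
  simp only [HSpan, VSpan, transpose_hPoint, transpose_hSeg]

theorem transpose_vSpan {i a b : ℕ} : T.transpose.VSpan i a b ↔ T.HSpan i a b := by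
  simp only [HSpan, VSpan, transpose_vPoint, transpose_vSeg]

theorem transpose_isHEdge {a b j : ℕ} : T.transpose.IsHEdge a b j ↔ T.IsVEdge j a b := by
  simp only [IsHEdge, IsVEdge, transpose_isVertex, transpose_hSpan]

theorem transpose_isVEdge {i a b : ℕ} : T.transpose.IsVEdge i a b ↔ T.IsHEdge a b i := by
  simp only [IsHEdge, IsVEdge, transpose_isVertex, transpose_vSpan]

theorem transpose_hExtension {p a b j : ℕ} :
    T.transpose.HExtension p a b j ↔ T.VExtension p j a b := by
  simp only [HExtension, VExtension, IsTRight, IsTLeft, IsTUp, IsTDown, transpose_hSeg,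
    transpose_vSeg, transpose_isInteriorVertex, transpose_vPoint]
  refine exists_congr fun i => ?_
  tauto

theorem transpose_vExtension {p i a b : ℕ} :
    T.transpose.VExtension p i a b ↔ T.HExtension p a b i :=
  transpose_hExtension (T := T.transpose).symm

/-- The point `(i, j)` lies in the extension of a horizontal T-junction. -/
def HReach (T : TMesh m n) (p i j : ℕ) : Prop :=
  ∃ x₁ x₂, T.HExtension p x₁ x₂ j ∧ x₁ ≤ i ∧ i ≤ x₂

/-- The point `(i, j)` lies in the extension of a vertical T-junction. -/
def VReach (T : TMesh m n) (q i j : ℕ) : Prop :=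
  ∃ y₁ y₂, T.VExtension q i y₁ y₂ ∧ y₁ ≤ j ∧ j ≤ y₂

theorem transpose_hReach {p i j : ℕ} : T.transpose.HReach p i j ↔ T.VReach p j i := by
  simp only [HReach, VReach, transpose_hExtension]

theorem IsAdmissible.transpose {p q : ℕ} (h : T.IsAdmissible p q) :
    T.transpose.IsAdmissible q p where
  vertical_lines i j h1 h2 h3 h4 h5 := transpose_vSeg.2 (h.horizontal_lines j i h3 h4 h1 h2 h5)
  horizontal_lines i j h1 h2 h3 h4 h5 := transpose_hSeg.2 (h.vertical_lines j i h3 h4 h1 h2 h5)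
  frame_valence i j h1 h2 := by
    have := h.frame_valence j i (transpose_isInteriorVertex.1 h1) (by tauto)
    simp only [HasValenceFour, transpose_hSeg, transpose_vSeg] at *
    tauto

theorem IsAnalysisSuitable.not_reach {p q : ℕ} (h : T.IsAnalysisSuitable p q) {i j : ℕ}
    (h1 : T.HReach p i j) : ¬ T.VReach q i j := by
  rintro ⟨y₁, y₂, hV, hj⟩
  obtain ⟨x₁, x₂, hH, hi⟩ := h1
  exact h x₁ x₂ j i y₁ y₂ hH hV ⟨hi, hj⟩

theorem IsAnalysisSuitable.transpose {p q : ℕ} (h : T.IsAnalysisSuitable p q) :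
    T.transpose.IsAnalysisSuitable q p := fun x₁ x₂ j i y₁ y₂ h1 h2 h3 =>
  h y₁ y₂ i j x₁ x₂ (transpose_vExtension.1 h2) (transpose_hExtension.1 h1) ⟨h3.2, h3.1⟩

theorem IsAnchor.transpose {p q : ℕ} {A : IndexRect} (h : T.IsAnchor p q A) :
    T.transpose.IsAnchor q p A.transpose where
  active_horizontal := h.active_vertical
  active_vertical := h.active_horizontal
  odd_odd hq hp := by
    obtain ⟨h1, h2, h3⟩ := h.odd_odd hp hq
    exact ⟨h2, h1, transpose_isVertex.2 h3⟩
  even_odd hq hp := by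
    obtain ⟨h1, h2⟩ := h.odd_even hp hq
    exact ⟨h1, transpose_isHEdge.2 h2⟩
  odd_even hq hp := by
    obtain ⟨h1, h2⟩ := h.even_odd hp hq
    exact ⟨h1, transpose_isVEdge.2 h2⟩
  even_even hq hp := h.even_even hp hq

/-! ### Cells, segments and T-junctions -/

theorem cell_unique {C D : IndexRect} (hC : C ∈ T.cells) (hD : D ∈ T.cells) (i j : ℕ)
    (h1 : C.left ≤ i ∧ i < C.right) (h2 : C.bottom ≤ j ∧ j < C.top)
    (h3 : D.left ≤ i ∧ i < D.right) (h4 : D.bottom ≤ j ∧ j < D.top) : C = D := by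
  have a := T.cell_horizontal C hC
  have b := T.cell_vertical C hC
  exact (T.partition i j (by omega) (by omega) (by omega) (by omega)).unique ⟨hC, h1, h2⟩
    ⟨hD, h3, h4⟩

/-- A cell with this segment on its boundary would share with `C` the unit square just above or just
below the segment. -/
theorem not_hSeg_inside {C : IndexRect} (hC : C ∈ T.cells) {i j : ℕ}
    (h1 : C.left ≤ i ∧ i < C.right) (h2 : C.bottom < j ∧ j < C.top) : ¬ T.HSeg i j := by
  rintro ⟨D, hD, hj, hi⟩
  have b := T.cell_vertical D hD
  rcases hj with hj | hj
  · have := cell_unique hC hD i j h1 ⟨by omega, by omega⟩ hi ⟨by omega, by omega⟩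
    subst this
    omega
  · have := cell_unique hC hD i (j - 1) h1 ⟨by omega, by omega⟩ hi ⟨by omega, by omega⟩
    subst this
    omega

theorem not_vSeg_inside {C : IndexRect} (hC : C ∈ T.cells) {i j : ℕ}
    (h1 : C.left < i ∧ i < C.right) (h2 : C.bottom ≤ j ∧ j < C.top) : ¬ T.VSeg i j :=
  fun h => not_hSeg_inside (T := T.transpose) (C := C.transpose) hC h2 h1 (transpose_hSeg.2 h)

theorem HSeg.bounds {i j : ℕ} (h : T.HSeg i j) : (1 ≤ i ∧ i < m) ∧ 1 ≤ j ∧ j ≤ n := by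
  obtain ⟨C, hC, hj, hi⟩ := h
  have a := T.cell_horizontal C hC
  have b := T.cell_vertical C hC
  omega

theorem hPoint_iff {i j : ℕ} : T.HPoint i j ↔ T.HSeg i j ∨ T.HSeg (i - 1) j := by
  constructor
  · rintro ⟨C, hC, hj, h1, h2⟩
    have a := T.cell_horizontal C hC
    rcases h2.lt_or_eq with h | h
    · exact Or.inl ⟨C, hC, hj, h1, h⟩
    · exact Or.inr ⟨C, hC, hj, by omega, by omega⟩
  · rintro (⟨C, hC, hj, h1, h2⟩ | ⟨C, hC, hj, h1, h2⟩)
    · exact ⟨C, hC, hj, h1, h2.le⟩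
    · have a := T.cell_horizontal C hC
      exact ⟨C, hC, hj, by omega, by omega⟩

theorem vPoint_iff {i j : ℕ} : T.VPoint i j ↔ T.VSeg i j ∨ T.VSeg i (j - 1) := by
  simpa only [transpose_hPoint, transpose_hSeg] using hPoint_iff (T := T.transpose) (i := j) (j := i)

theorem IsVertex.hPoint {i j : ℕ} (h : T.IsVertex i j) : T.HPoint i j := by
  obtain ⟨C, hC, hi, hj⟩ := h
  have a := T.cell_horizontal C hC
  exact ⟨C, hC, hj, by omega, by omega⟩

theorem IsVertex.vPoint {i j : ℕ} (h : T.IsVertex i j) : T.VPoint i j :=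
  transpose_hPoint.1 (transpose_isVertex.2 h).hPoint

theorem isVertex_of_crossing {i j : ℕ} (h1 : T.HSeg (i - 1) j) (h2 : T.HSeg i j)
    (h : T.VPoint i j) : T.IsVertex i j := by
  obtain ⟨C, hC, hi, hj⟩ := h
  have a := T.cell_horizontal C hC
  by_cases hb : j = C.bottom ∨ j = C.top
  · exact ⟨C, hC, hi, hb⟩
  · push Not at hb
    rcases hi with hi | hi
    · exact absurd h2 (not_hSeg_inside hC ⟨by omega, by omega⟩ ⟨by omega, by omega⟩)
    · exact absurd h1 (not_hSeg_inside hC ⟨by omega, by omega⟩ ⟨by omega, by omega⟩)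

theorem HSpan.hPoint {j a b x : ℕ} (h : T.HSpan j a b) (h1 : a ≤ x) (h2 : x ≤ b) :
    T.HPoint x j := by
  rcases h1.eq_or_lt with rfl | h1
  · exact h.1
  · exact hPoint_iff.2 (Or.inr (h.2 (x - 1) (by omega) (by omega)))

theorem hSpan_of_hSeg {j a b : ℕ} (hab : a < b) (h : ∀ i, a ≤ i → i < b → T.HSeg i j) :
    T.HSpan j a b :=
  ⟨hPoint_iff.2 (Or.inl (h a le_rfl hab)), h⟩

/-- If the horizontal line `j` contains one interval but not another, then it has a gap between
them. -/
theorem HSpan.exists_gap {j a b c d : ℕ} (h : T.HSpan j a b) (hcd : c ≤ d)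
    (h' : ¬ T.HSpan j c d) :
    (∃ k, b ≤ k ∧ k < d ∧ ¬ T.HSeg k j) ∨ ∃ k, c ≤ k ∧ k < a ∧ ¬ T.HSeg k j := by
  rcases hcd.eq_or_lt with rfl | hcd
  · have hc : ¬ T.HPoint c j := fun hc => h' ⟨hc, fun i _ _ => by omega⟩
    have hc' := not_or.1 fun hcon => hc (hPoint_iff.2 hcon)
    rcases lt_or_ge c a with h1 | h1
    · exact Or.inr ⟨c, le_rfl, h1, hc'.1⟩
    · rcases lt_or_ge b c with h2 | h2
      · exact Or.inl ⟨c - 1, by omega, by omega, hc'.2⟩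
      · exact absurd (h.hPoint h1 h2) hc
  · have : ∃ k, c ≤ k ∧ k < d ∧ ¬ T.HSeg k j := by
      by_contra! hcon
      exact h' (hSpan_of_hSeg hcd hcon)
    obtain ⟨k, h1, h2, h3⟩ := this
    rcases lt_or_ge k a with h4 | h4
    · exact Or.inr ⟨k, h1, h4, h3⟩
    · refine Or.inl ⟨k, ?_, h2, h3⟩
      by_contra h5
      exact h3 (h.2 k h4 (by omega))

variable {p q : ℕ}

theorem IsAdmissible.lt_of_not_hSeg (hT : T.IsAdmissible p q) {i j : ℕ} (hi : 1 ≤ i) (hi' : i < m)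
    (hj : 1 ≤ j) (hj' : j ≤ n) (h : ¬ T.HSeg i j) : 1 < j ∧ j < n := by
  by_contra hcon
  exact h (hT.horizontal_lines i j hi hi' hj hj' (by omega))

/-- The cell containing the unit square up and to the left of `(i, j)` must straddle the line `j`.
It cannot extend past `i`, where the segment begins, so its right side supplies both vertical edges
of the T-junction. -/
theorem isTLeft_of_hSeg (hT : T.IsAdmissible p q) {i j : ℕ} (hi : 1 < i) (h1 : T.HSeg i j)
    (h2 : ¬ T.HSeg (i - 1) j) : T.IsTLeft i j := by
  have hb := h1.bounds
  have hj := hT.lt_of_not_hSeg (by omega) (by omega) (by omega) (by omega) h2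
  obtain ⟨C, ⟨hC, hCi, hCj⟩, -⟩ := T.partition (i - 1) j (by omega) (by omega) (by omega) (by omega)
  obtain ⟨D, hD, hDj, hDi⟩ := h1
  have hCb : C.bottom < j := by
    rcases hCj.1.lt_or_eq with h | h
    · exact h
    · exact absurd ⟨C, hC, Or.inl h.symm, hCi⟩ h2
  have hCr : C.right = i := by
    by_contra hne
    exact not_hSeg_inside hC ⟨by omega, by omega⟩ ⟨hCb, hCj.2⟩ ⟨D, hD, hDj, hDi⟩
  have hDl : D.left = i := by
    by_contra hne
    exact h2 ⟨D, hD, hDj, by omega, by omega⟩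
  exact ⟨⟨⟨D, hD, Or.inl hDl.symm, hDj⟩, by omega, hj⟩, ⟨D, hD, hDj, hDi⟩, h2,
    ⟨C, hC, Or.inr hCr.symm, hCj⟩, ⟨C, hC, Or.inr hCr.symm, by omega, by omega⟩⟩

theorem isTRight_of_hSeg (hT : T.IsAdmissible p q) {i j : ℕ} (hi : i < m) (h1 : T.HSeg (i - 1) j)
    (h2 : ¬ T.HSeg i j) : T.IsTRight i j := by
  have hb := h1.bounds
  have hj := hT.lt_of_not_hSeg (by omega) (by omega) (by omega) (by omega) h2
  obtain ⟨C, ⟨hC, hCi, hCj⟩, -⟩ := T.partition i j (by omega) (by omega) (by omega) (by omega)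
  obtain ⟨D, hD, hDj, hDi⟩ := h1
  have hCb : C.bottom < j := by
    rcases hCj.1.lt_or_eq with h | h
    · exact h
    · exact absurd ⟨C, hC, Or.inl h.symm, hCi⟩ h2
  have hCl : C.left = i := by
    by_contra hne
    exact not_hSeg_inside (i := i - 1) hC ⟨by omega, by omega⟩ ⟨hCb, hCj.2⟩ ⟨D, hD, hDj, hDi⟩
  have hDr : D.right = i := by
    by_contra hne
    exact h2 ⟨D, hD, hDj, by omega, by omega⟩
  exact ⟨⟨⟨D, hD, Or.inr hDr.symm, hDj⟩, by omega, hj⟩, h2, ⟨D, hD, hDj, hDi⟩,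
    ⟨C, hC, Or.inl hCl.symm, hCj⟩, ⟨C, hC, Or.inl hCl.symm, by omega, by omega⟩⟩

/-- Walking from `i` towards the gap, the line stops for the first time at a T-junction. -/
theorem exists_isTLeft (hT : T.IsAdmissible p q) {i j k : ℕ} (h : T.HPoint i j) (hk : 1 ≤ k)
    (hki : k < i) (hgap : ¬ T.HSeg k j) : ∃ x, k < x ∧ x ≤ i ∧ T.IsTLeft x j := by
  induction i, hki using Nat.le_induction with
  | base =>
    rcases hPoint_iff.1 h with h | h
    · exact ⟨k + 1, by omega, le_rfl, isTLeft_of_hSeg hT (by omega) h (by simpa using hgap)⟩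
    · exact absurd h (by simpa using hgap)
  | succ i hi ih =>
    by_cases hs : T.HSeg i j
    · obtain ⟨x, h1, h2, h3⟩ := ih (hPoint_iff.2 (Or.inl hs))
      exact ⟨x, h1, by omega, h3⟩
    · rcases hPoint_iff.1 h with h | h
      · exact ⟨i + 1, by omega, le_rfl, isTLeft_of_hSeg hT (by omega) h (by simpa using hs)⟩
      · exact absurd h (by simpa using hs)

theorem exists_isTRight (hT : T.IsAdmissible p q) {i j k : ℕ} (h : T.HPoint i j) (hik : i ≤ k)
    (hk : k < m) (hgap : ¬ T.HSeg k j) : ∃ x, i ≤ x ∧ x ≤ k ∧ T.IsTRight x j := by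
  induction k, hik using Nat.le_induction with
  | base =>
    rcases hPoint_iff.1 h with h | h
    · exact absurd h hgap
    · exact ⟨i, le_rfl, le_rfl, isTRight_of_hSeg hT hk h hgap⟩
  | succ k hi ih =>
    by_cases hs : T.HSeg k j
    · exact ⟨k + 1, by omega, le_rfl, isTRight_of_hSeg hT hk (by simpa using hs) hgap⟩
    · obtain ⟨x, h1, h2, h3⟩ := ih (by omega) hs
      exact ⟨x, h1, by omega, h3⟩

theorem IsAdmissible.active_of_not_valenceFour (hT : T.IsAdmissible p q) {i j : ℕ}
    (h : T.IsInteriorVertex i j) (h' : ¬ T.HasValenceFour i j) :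
    1 + (p + 1) / 2 < i ∧ i + (p + 1) / 2 < m := by
  by_contra hcon
  exact h' (hT.frame_valence i j h (by omega))

/-- T-junctions lie strictly inside the active columns, so the `(p + 1) / 2` outermost full columns
lie to the right. The bound `m + 1` lets column `m` count, and extensions to the right never run out
of skeleton points. -/
theorem IsAdmissible.le_gapCount (hT : T.IsAdmissible p q) {i j : ℕ}
    (h : T.IsInteriorVertex i j) (h' : ¬ T.HasValenceFour i j) :
    (p + 1) / 2 ≤ gapCount {x | T.VPoint x j} i (m + 1) := by
  have ha := hT.active_of_not_valenceFour h h'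
  have := TSpline.le_gapCount (S := {x | T.VPoint x j}) (a := m - (p + 1) / 2 + 1) (b := m)
    (l := i) (r := m + 1)
    (fun x h1 h2 => vPoint_iff.2 (Or.inl (hT.vertical_lines x j (by omega) h2 (by have := h.2; omega)
      (by have := h.2; omega) (by omega)))) (by omega) (by omega)
  omega

/-- An extension ends at, and includes, its last counted skeleton point. It therefore contains every
`z` with fewer skeleton points strictly in between than its length. -/
theorem IsTRight.hReach_right (hT : T.IsAdmissible p q) {i j z : ℕ} (h : T.IsTRight i j)
    (hz : i ≤ z) (hc : z = i ∨ gapCount {x | T.VPoint x j} i z < (p + 1) / 2) :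
    T.HReach p z j :=
  ⟨_, _, ⟨i, Or.inl ⟨h, rfl, rfl⟩⟩, (prevIndex_iterate_le _ _ _).trans hz,
    le_nextIndex_iterate _ hz hc (hT.le_gapCount h.1 fun h' => h.2.1 h'.1)⟩

theorem IsTRight.hReach_left (hT : T.IsAdmissible p q) {i j z : ℕ} (h : T.IsTRight i j)
    (hz : z ≤ i) (hc : z = i ∨ gapCount {x | T.VPoint x j} z i < p / 2) :
    T.HReach p z j :=
  ⟨_, _, ⟨i, Or.inl ⟨h, rfl, rfl⟩⟩, prevIndex_iterate_le_of _ hz hc,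
    hz.trans (le_nextIndex_iterate _ le_rfl (Or.inl rfl)
      (hT.le_gapCount h.1 fun h' => h.2.1 h'.1))⟩

theorem IsTLeft.hReach_left (hT : T.IsAdmissible p q) {i j z : ℕ} (h : T.IsTLeft i j)
    (hz : z ≤ i) (hc : z = i ∨ gapCount {x | T.VPoint x j} z i < (p + 1) / 2) :
    T.HReach p z j :=
  ⟨_, _, ⟨i, Or.inr ⟨h, rfl, rfl⟩⟩, prevIndex_iterate_le_of _ hz hc,
    hz.trans (le_nextIndex_iterate _ le_rfl (Or.inl rfl)
      ((by omega : p / 2 ≤ (p + 1) / 2).trans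
        (hT.le_gapCount h.1 fun h' => h.2.2.1 h'.2.1)))⟩

theorem IsTLeft.hReach_right (hT : T.IsAdmissible p q) {i j z : ℕ} (h : T.IsTLeft i j)
    (hz : i ≤ z) (hc : z = i ∨ gapCount {x | T.VPoint x j} i z < p / 2) :
    T.HReach p z j :=
  ⟨_, _, ⟨i, Or.inr ⟨h, rfl, rfl⟩⟩, (prevIndex_iterate_le _ _ _).trans hz,
    le_nextIndex_iterate _ hz hc ((by omega : p / 2 ≤ (p + 1) / 2).trans
        (hT.le_gapCount h.1 fun h' => h.2.2.1 h'.2.1))⟩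

/-! ### Anchors -/

/-- The properties of anchors that do not distinguish between the parities of the degrees. -/
structure IsAnchorRect (T : TMesh m n) (p q : ℕ) (A : IndexRect) : Prop where
  active_horizontal : 1 + (p + 1) / 2 ≤ A.left ∧ A.right + (p + 1) / 2 ≤ m
  active_vertical : 1 + (q + 1) / 2 ≤ A.bottom ∧ A.top + (q + 1) / 2 ≤ n
  horizontal : (Odd p ∧ A.left = A.right) ∨ (Even p ∧ A.left < A.right)
  vertical : (Odd q ∧ A.bottom = A.top) ∨ (Even q ∧ A.bottom < A.top)
  left_mem : A.left ∈ T.hIndexSet A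
  right_mem : A.right ∈ T.hIndexSet A
  bottom_mem : A.bottom ∈ T.vIndexSet A
  top_mem : A.top ∈ T.vIndexSet A
  horizontal_gap : ∀ i, A.left < i → i < A.right → i ∉ T.hIndexSet A
  vertical_gap : ∀ j, A.bottom < j → j < A.top → j ∉ T.vIndexSet A
  not_vPoint : ∀ i j, A.left < i → i < A.right → A.bottom < j → j < A.top → ¬ T.VPoint i j
  not_hPoint : ∀ i j, A.left < i → i < A.right → A.bottom < j → j < A.top → ¬ T.HPoint i j

theorem transpose_hIndexSet {A : IndexRect} :
    T.transpose.hIndexSet A.transpose = T.vIndexSet A := by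
  ext i
  exact transpose_vSpan

theorem transpose_vIndexSet {A : IndexRect} :
    T.transpose.vIndexSet A.transpose = T.hIndexSet A := by
  ext i
  exact transpose_hSpan

variable {A B : IndexRect}

theorem IsAnchorRect.transpose (h : T.IsAnchorRect p q A) :
    T.transpose.IsAnchorRect q p A.transpose where
  active_horizontal := h.active_vertical
  active_vertical := h.active_horizontal
  horizontal := h.vertical
  vertical := h.horizontal
  left_mem := transpose_hIndexSet ▸ h.bottom_mem
  right_mem := transpose_hIndexSet ▸ h.top_mem
  bottom_mem := transpose_vIndexSet ▸ h.left_mem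
  top_mem := transpose_vIndexSet ▸ h.right_mem
  horizontal_gap := transpose_hIndexSet ▸ h.vertical_gap
  vertical_gap := transpose_vIndexSet ▸ h.horizontal_gap
  not_vPoint i j h1 h2 h3 h4 h5 := h.not_hPoint j i h3 h4 h1 h2 (transpose_vPoint.1 h5)
  not_hPoint i j h1 h2 h3 h4 h5 := h.not_vPoint j i h3 h4 h1 h2 (transpose_hPoint.1 h5)

theorem IsAnchor.isAnchorRect_of_even_odd (h : T.IsAnchor p q A) (hp : Even p) (hq : Odd q) :
    T.IsAnchorRect p q A := by
  obtain ⟨hb, hlr, hl, hr, hs, hg⟩ := h.even_odd hp hq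
  have hspan : ∀ i, T.VPoint i A.bottom → i ∈ T.hIndexSet A := fun i hi =>
    ⟨hi, fun j _ _ => by omega⟩
  refine ⟨h.active_horizontal, h.active_vertical, Or.inr ⟨hp, hlr⟩, Or.inl ⟨hq, hb⟩,
    hspan _ hl.vPoint, hspan _ hr.vPoint, hs, hb ▸ hs, fun i h1 h2 hi => ?_,
    fun j _ _ => by omega, fun i j _ _ _ _ => by omega, fun i j _ _ _ _ => by omega⟩
  exact hg i h1 h2 (isVertex_of_crossing (hs.2 _ (by omega) (by omega))
    (hs.2 _ h1.le h2) hi.1)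

theorem IsAnchor.isAnchorRect (h : T.IsAnchor p q A) : T.IsAnchorRect p q A := by
  rcases Nat.even_or_odd p with hp | hp <;> rcases Nat.even_or_odd q with hq | hq
  · have hA := h.even_even hp hq
    have a := T.cell_horizontal A hA
    have b := T.cell_vertical A hA
    have hh : ∀ i, A.left < i → i < A.right → ∀ j, A.bottom ≤ j → j < A.top → ¬ T.VSeg i j :=
      fun i h1 h2 j h3 h4 => not_vSeg_inside hA ⟨h1, h2⟩ ⟨h3, h4⟩
    have hv : ∀ j, A.bottom < j → j < A.top → ∀ i, A.left ≤ i → i < A.right → ¬ T.HSeg i j :=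
      fun i h1 h2 j h3 h4 => not_hSeg_inside hA ⟨h3, h4⟩ ⟨h1, h2⟩
    refine ⟨h.active_horizontal, h.active_vertical, Or.inr ⟨hp, a.2.1⟩, Or.inr ⟨hq, b.2.1⟩,
      ⟨⟨A, hA, Or.inl rfl, le_rfl, b.2.1.le⟩, fun j h1 h2 => ⟨A, hA, Or.inl rfl, h1, h2⟩⟩,
      ⟨⟨A, hA, Or.inr rfl, le_rfl, b.2.1.le⟩, fun j h1 h2 => ⟨A, hA, Or.inr rfl, h1, h2⟩⟩,
      ⟨⟨A, hA, Or.inl rfl, le_rfl, a.2.1.le⟩, fun j h1 h2 => ⟨A, hA, Or.inl rfl, h1, h2⟩⟩,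
      ⟨⟨A, hA, Or.inr rfl, le_rfl, a.2.1.le⟩, fun j h1 h2 => ⟨A, hA, Or.inr rfl, h1, h2⟩⟩,
      fun i h1 h2 hi => hh i h1 h2 _ le_rfl b.2.1 (hi.2 _ le_rfl b.2.1),
      fun j h1 h2 hj => hv j h1 h2 _ le_rfl a.2.1 (hj.2 _ le_rfl a.2.1), ?_, ?_⟩
    · intro i j h1 h2 h3 h4 h5
      rcases vPoint_iff.1 h5 with h5 | h5
      · exact hh i h1 h2 j h3.le h4 h5
      · exact hh i h1 h2 (j - 1) (by omega) (by omega) h5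
    · intro i j h1 h2 h3 h4 h5
      rcases hPoint_iff.1 h5 with h5 | h5
      · exact hv j h3 h4 i h1.le h2 h5
      · exact hv j h3 h4 (i - 1) (by omega) (by omega) h5
  · exact h.isAnchorRect_of_even_odd hp hq
  · exact (h.transpose.isAnchorRect_of_even_odd hq hp).transpose
  · obtain ⟨h1, h2, h3⟩ := h.odd_odd hp hq
    have hl : A.left ∈ T.hIndexSet A := ⟨h3.vPoint, fun j _ _ => by omega⟩
    have hb : A.bottom ∈ T.vIndexSet A := ⟨h3.hPoint, fun j _ _ => by omega⟩
    exact ⟨h.active_horizontal, h.active_vertical, Or.inl ⟨hp, h1⟩, Or.inl ⟨hq, h2⟩,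
      hl, h1 ▸ hl, hb, h2 ▸ hb, fun i _ _ => by omega, fun j _ _ => by omega,
      fun i j _ _ => by omega, fun i j _ _ => by omega⟩

theorem IsAnchorRect.left_le (h : T.IsAnchorRect p q A) : A.left ≤ A.right := by
  rcases h.horizontal with h | h <;> omega

/-- The range of the horizontal index vector of the anchor `A`. -/
def HHull (T : TMesh m n) (p : ℕ) (A : IndexRect) (i : ℕ) : Prop :=
  InHull (T.hIndexSet A) ((p + 1) / 2) A.left A.right i

/-- The range of the vertical index vector of the anchor `A`. -/
def VHull (T : TMesh m n) (q : ℕ) (A : IndexRect) (j : ℕ) : Prop :=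
  InHull (T.vIndexSet A) ((q + 1) / 2) A.bottom A.top j

theorem transpose_hHull {j : ℕ} : T.transpose.HHull q A.transpose j ↔ T.VHull q A j := by
  simp only [HHull, VHull, transpose_hIndexSet]
  rfl

theorem transpose_vHull {i : ℕ} : T.transpose.VHull p A.transpose i ↔ T.HHull p A i := by
  simp only [HHull, VHull, transpose_vIndexSet]
  rfl

/-- Counting to the far end of the anchor adds `A.left` itself when `p` is even and nothing when `p`
is odd. The bound `p / 2` matches the length of an edge extension. -/
theorem IsAnchorRect.gapCount_right (h : T.IsAnchorRect p q A) {i : ℕ} (hi : T.HHull p A i) :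
    gapCount (T.hIndexSet A) i A.right ≤ p / 2 := by
  rcases le_or_gt A.left i with hli | hli
  · by_contra hcon
    obtain ⟨x, hx, h1, h2⟩ := gapCount_pos (by omega : 0 < gapCount (T.hIndexSet A) i A.right)
    exact h.horizontal_gap x (by omega) h2 hx
  · have h2 : gapCount (T.hIndexSet A) i A.left < (p + 1) / 2 := by
      rcases hi.2 with h | h
      · omega
      · exact h
    rcases h.horizontal with ⟨hp, hlr⟩ | ⟨hp, hlr⟩
    · rw [← hlr]
      omega
    · have := gapCount_le_add_one (S := T.hIndexSet A) (a := i) (b := A.right) (a' := i)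
        (b' := A.left) (y := A.left) fun x hx h3 h4 => by
          have := h.horizontal_gap x
          by_contra hcon
          exact this (by omega) h4 hx
      have := Nat.even_iff.1 hp
      omega

theorem IsAnchorRect.gapCount_left (h : T.IsAnchorRect p q A) {i : ℕ} (hi : T.HHull p A i) :
    gapCount (T.hIndexSet A) A.left i ≤ p / 2 := by
  rcases le_or_gt i A.right with hli | hli
  · by_contra hcon
    obtain ⟨x, hx, h1, h2⟩ := gapCount_pos (by omega : 0 < gapCount (T.hIndexSet A) A.left i)
    exact h.horizontal_gap x h1 (by omega) hx
  · have h2 : gapCount (T.hIndexSet A) A.right i < (p + 1) / 2 := by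
      rcases hi.1 with h | h
      · omega
      · exact h
    rcases h.horizontal with ⟨hp, hlr⟩ | ⟨hp, hlr⟩
    · rw [hlr]
      omega
    · have := gapCount_le_add_one (S := T.hIndexSet A) (a := A.left) (b := i) (a' := A.right)
        (b' := i) (y := A.right) fun x hx h3 h4 => by
          have := h.horizontal_gap x
          by_contra hcon
          exact this h3 (by omega) hx
      have := Nat.even_iff.1 hp
      omega

/-! ### Defects and the descent towards an anchor -/

/-- `(y, j)` lies in a horizontal T-junction extension and in the vertical skeleton, but the
vertical line through it does not reach the anchor `A`. -/
def Defect (T : TMesh m n) (p : ℕ) (A : IndexRect) (j y : ℕ) : Prop :=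
  T.HReach p y j ∧ T.VPoint y j ∧ y ∉ T.hIndexSet A

/-- If the face extension stops short of `i`, it has met at least `(p + 1) / 2` skeleton points
before `i`, more than the index set has between `A` and `i`. The first one missing from the index
set is still within reach. -/
theorem IsTRight.reach_or_defect_right (hT : T.IsAdmissible p q) {x i j : ℕ} (hx : T.IsTRight x j)
    (hAx : A.right ≤ x) (hxi : x < i) (hi : T.HHull p A i) :
    T.HReach p i j ∨ ∃ y, x < y ∧ y < i ∧ T.Defect p A j y := by
  rcases lt_or_ge (gapCount {x | T.VPoint x j} x i) ((p + 1) / 2) with hc | hc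
  · exact Or.inl (hx.hReach_right hT hxi.le (Or.inr hc))
  · have h1 : gapCount (T.hIndexSet A) A.right i < (p + 1) / 2 := by
      rcases hi.1 with h | h
      · omega
      · exact h
    obtain ⟨y, hy, hy', h2, h3, h4, -⟩ := exists_first_not_mem (d := (p + 1) / 2 - 1)
      ((gapCount_mono hAx le_rfl fun x hx _ _ => hx).trans_lt h1) hc (by omega)
    exact Or.inr ⟨y, h2, h3, hx.hReach_right hT h2.le (Or.inr (by omega)), hy, hy'⟩

theorem IsTLeft.reach_or_defect_left (hT : T.IsAdmissible p q) {x i j : ℕ} (hx : T.IsTLeft x j)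
    (hAx : x ≤ A.left) (hxi : i < x) (hi : T.HHull p A i) :
    T.HReach p i j ∨ ∃ y, i < y ∧ y < x ∧ T.Defect p A j y := by
  rcases lt_or_ge (gapCount {x | T.VPoint x j} i x) ((p + 1) / 2) with hc | hc
  · exact Or.inl (hx.hReach_left hT hxi.le (Or.inr hc))
  · have h1 : gapCount (T.hIndexSet A) i A.left < (p + 1) / 2 := by
      rcases hi.2 with h | h
      · omega
      · exact h
    obtain ⟨y, hy, hy', h2, h3, h4, -⟩ := exists_last_not_mem (d := (p + 1) / 2 - 1)
      ((gapCount_mono le_rfl hAx fun x hx _ _ => hx).trans_lt h1) hc (by omega)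
    exact Or.inr ⟨y, h2, h3, hx.hReach_left hT h3.le (Or.inr (by omega)), hy, hy'⟩

/-- The edge extension is counted against the far end `A.right`. If the T-junction's own column is
in the index set, it uses up one of the at most `p / 2` places, which leaves too few for the
skeleton points met; otherwise that column is itself the defect. -/
theorem IsTRight.reach_or_defect_left (hT : T.IsAdmissible p q) (hA : T.IsAnchorRect p q A)
    {x i j : ℕ} (hx : T.IsTRight x j) (hAx : x < A.right) (hxi : i ≤ x) (hi : T.HHull p A i) :
    T.HReach p i j ∨ ∃ y, i < y ∧ y ≤ x ∧ T.Defect p A j y := by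
  have hxS : x ∈ {x | T.VPoint x j} := hx.1.1.vPoint
  rcases hxi.eq_or_lt with rfl | hxi
  · exact Or.inl (hx.hReach_left hT le_rfl (Or.inl rfl))
  rcases lt_or_ge (gapCount {x | T.VPoint x j} i x) (p / 2) with hc | hc
  · exact Or.inl (hx.hReach_left hT hxi.le (Or.inr hc))
  by_cases hxA : x ∈ T.hIndexSet A
  · have h1 := hA.gapCount_right hi
    have h2 : gapCount (T.hIndexSet A) i x < gapCount (T.hIndexSet A) i A.right :=
      gapCount_lt le_rfl hAx.le (fun x hx _ _ => hx) hxA hxi hAx (Or.inr le_rfl)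
    obtain ⟨y, hy, hy', h3, h4, h5, -⟩ := exists_last_not_mem (d := p / 2 - 1)
      (h2.trans_le h1) hc (by omega)
    exact Or.inr ⟨y, h3, h4.le, hx.hReach_left hT h4.le (Or.inr (by omega)), hy, hy'⟩
  · exact Or.inr ⟨x, hxi, le_rfl, hx.hReach_left hT le_rfl (Or.inl rfl), hxS, hxA⟩

theorem IsTLeft.reach_or_defect_right (hT : T.IsAdmissible p q) (hA : T.IsAnchorRect p q A)
    {x i j : ℕ} (hx : T.IsTLeft x j) (hAx : A.left < x) (hxi : x ≤ i) (hi : T.HHull p A i) :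
    T.HReach p i j ∨ ∃ y, x ≤ y ∧ y < i ∧ T.Defect p A j y := by
  have hxS : x ∈ {x | T.VPoint x j} := hx.1.1.vPoint
  rcases hxi.eq_or_lt with rfl | hxi
  · exact Or.inl (hx.hReach_right hT le_rfl (Or.inl rfl))
  rcases lt_or_ge (gapCount {x | T.VPoint x j} x i) (p / 2) with hc | hc
  · exact Or.inl (hx.hReach_right hT hxi.le (Or.inr hc))
  by_cases hxA : x ∈ T.hIndexSet A
  · have h1 := hA.gapCount_left hi
    have h2 : gapCount (T.hIndexSet A) x i < gapCount (T.hIndexSet A) A.left i :=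
      gapCount_lt hAx.le le_rfl (fun x hx _ _ => hx) hxA hAx hxi (Or.inl le_rfl)
    obtain ⟨y, hy, hy', h3, h4, h5, -⟩ := exists_first_not_mem (d := p / 2 - 1)
      (h2.trans_le h1) hc (by omega)
    exact Or.inr ⟨y, h3.le, h4, hx.hReach_right hT h3.le (Or.inr (by omega)), hy, hy'⟩
  · exact Or.inr ⟨x, le_rfl, hxi, hx.hReach_right hT le_rfl (Or.inl rfl), hxS, hxA⟩

/-- A horizontal line which meets `(i, j)` but does not span the anchor `A`, or conversely, either
carries a T-junction extension through `(i, j)` or has a defect between `i` and `A`. -/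
theorem reach_or_defect (hT : T.IsAdmissible p q) (hA : T.IsAnchorRect p q A) {i j : ℕ}
    (hi : 1 ≤ i ∧ i ≤ m) (hull : T.HHull p A i) (h : ¬ (T.HPoint i j ↔ j ∈ T.vIndexSet A)) :
    T.HReach p i j ∨ ∃ y, ((A.left < y ∧ y < i) ∨ (i < y ∧ y < A.right)) ∧ T.Defect p A j y := by
  have hlr := hA.left_le
  have hact := hA.active_horizontal
  have hpt : T.HPoint i j ↔ T.HSpan j i i := ⟨fun h => ⟨h, fun k _ _ => by omega⟩, fun h => h.1⟩
  by_cases hS : T.HSpan j A.left A.right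
  · have hP : ¬ T.HSpan j i i := fun hP => h ⟨fun _ => hS, fun _ => hpt.2 hP⟩
    rcases hS.exists_gap le_rfl hP with ⟨k, h1, h2, h3⟩ | ⟨k, h1, h2, h3⟩
    · obtain ⟨x, h4, h5, hx⟩ := exists_isTRight hT (hS.hPoint hlr le_rfl) h1 (by omega) h3
      refine (hx.reach_or_defect_right hT h4 (by omega) hull).imp_right ?_
      rintro ⟨y, h6, h7, h8⟩
      exact ⟨y, Or.inl ⟨by omega, h7⟩, h8⟩
    · obtain ⟨x, h4, h5, hx⟩ := exists_isTLeft hT hS.1 (by omega) h2 h3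
      refine (hx.reach_or_defect_left hT h5 (by omega) hull).imp_right ?_
      rintro ⟨y, h6, h7, h8⟩
      exact ⟨y, Or.inr ⟨h6, by omega⟩, h8⟩
  · have hP : T.HSpan j i i := by
      by_contra hP
      exact h ⟨fun h => absurd (hpt.1 h) hP, fun h => absurd h hS⟩
    rcases hP.exists_gap hlr hS with ⟨k, h1, h2, h3⟩ | ⟨k, h1, h2, h3⟩
    · obtain ⟨x, h4, h5, hx⟩ := exists_isTRight hT hP.1 h1 (by omega) h3
      refine (hx.reach_or_defect_left hT hA (by omega) h4 hull).imp_right ?_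
      rintro ⟨y, h6, h7, h8⟩
      exact ⟨y, Or.inr ⟨h6, by omega⟩, h8⟩
    · obtain ⟨x, h4, h5, hx⟩ := exists_isTLeft hT hP.1 (by omega) h2 h3
      refine (hx.reach_or_defect_right hT hA (by omega) h5 hull).imp_right ?_
      rintro ⟨y, h6, h7, h8⟩
      exact ⟨y, Or.inl ⟨by omega, h7⟩, h8⟩

/-- A distance of the index `i` from the interval `(l, r)`. -/
def intervalDist (l r i : ℕ) : ℕ := if l < i ∧ i < r then 0 else (i - l) + (r - i)

/-- Descent that exchanges the two directions at each step, hence the generalization over the mesh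
and the degrees. The measure is twice the distance to the anchor plus one bit, because a step taken
with `j` already inside the anchor's vertical range does not shorten the distance. -/
theorem vPoint_iff_aux (N : ℕ) {m n : ℕ} {T : TMesh m n} {p q : ℕ} {A : IndexRect}
    (hT : T.IsAdmissible p q) (hAS : T.IsAnalysisSuitable p q) (hA : T.IsAnchorRect p q A)
    {i j : ℕ} (hi : 1 ≤ i ∧ i ≤ m) (hj : 1 ≤ j ∧ j ≤ n) (hHi : T.HHull p A i)
    (hVj : T.VHull q A j) (hR : T.HReach p i j)
    (hN : 2 * (intervalDist A.left A.right i + intervalDist A.bottom A.top j) +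
      (if A.bottom < j ∧ j < A.top then 1 else 0) < N) :
    T.VPoint i j ↔ i ∈ T.hIndexSet A := by
  induction N generalizing m n p q i j A with
  | zero => omega
  | succ N ih =>
    by_contra hcon
    -- A vertical extension through `(i, j)` crosses the given horizontal one; a defect `(i, y)`
    -- contradicts the induction hypothesis in the transposed mesh.
    obtain hV | ⟨y, hy, hyR, hyP, hyA⟩ := reach_or_defect hT.transpose hA.transpose hj
      (transpose_hHull.2 hVj) (i := j) (j := i)
      (by rwa [transpose_hPoint, transpose_vIndexSet])
    · exact hAS.not_reach hR (transpose_hReach.1 hV)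
    · have hlr := hA.left_le
      have hbt : A.bottom ≤ A.top := hA.transpose.left_le
      have h1 := hA.active_vertical
      change (A.bottom < y ∧ y < j) ∨ (j < y ∧ y < A.top) at hy
      refine hyA ((ih hT.transpose hAS.transpose hA.transpose (by omega) hi
        (transpose_hHull.2 (hVj.of_between hy)) (transpose_vHull.2 hHi) hyR ?_).1 hyP)
      change 2 * (intervalDist A.bottom A.top y + intervalDist A.left A.right i) +
        (if A.left < i ∧ i < A.right then 1 else 0) < N
      -- Inside the anchor both sides of the equivalence fail. Elsewhere, if the old bit is 1 the
      -- new one is 0; if it is 0, the distance drops, which outweighs a new bit.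
      by_cases hij : (A.left < i ∧ i < A.right) ∧ (A.bottom < j ∧ j < A.top)
      · exact absurd ⟨fun h => absurd h (hA.not_vPoint i j hij.1.1 hij.1.2 hij.2.1 hij.2.2),
          fun h => absurd h (hA.horizontal_gap i hij.1.1 hij.1.2)⟩ hcon
      · unfold intervalDist at *
        split_ifs at * <;> omega

/-- Inside the index support of an anchor, the vertical lines that cross an extension of a
horizontal T-junction are exactly the lines that contribute to the index vector of the anchor. -/
theorem vPoint_iff_mem_hIndexSet (hT : T.IsAdmissible p q) (hAS : T.IsAnalysisSuitable p q)
    (hA : T.IsAnchorRect p q A) {i j : ℕ} (hi : 1 ≤ i ∧ i ≤ m) (hj : 1 ≤ j ∧ j ≤ n)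
    (hHi : T.HHull p A i) (hVj : T.VHull q A j) (hR : T.HReach p i j) :
    T.VPoint i j ↔ i ∈ T.hIndexSet A :=
  vPoint_iff_aux _ hT hAS hA hi hj hHi hVj hR (Nat.lt_succ_self _)

/-! ### Overlap of the index vectors of two anchors -/

/-- The horizontal index vectors of two anchors agree on the intersection of their ranges. -/
def HOverlap (T : TMesh m n) (p : ℕ) (A B : IndexRect) : Prop :=
  ∀ i, 1 ≤ i → i ≤ m → T.HHull p A i → T.HHull p B i → (i ∈ T.hIndexSet A ↔ i ∈ T.hIndexSet B)

/-- The line `j` breaks off at a T-junction before it has spanned `B`. As defects are excluded, the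
extension of this T-junction contains every `(i, j)` with `i` in both horizontal ranges, and there
both index sets coincide with the skeleton on line `j`. The break also separates the ends of the
anchors. -/
theorem HOverlap.of_line (hT : T.IsAdmissible p q) (hAS : T.IsAnalysisSuitable p q)
    (hA : T.IsAnchorRect p q A) (hB : T.IsAnchorRect p q B) {j : ℕ}
    (hjA : T.VHull q A j) (hjB : T.VHull q B j) (hA' : j ∈ T.vIndexSet A)
    (hB' : j ∉ T.vIndexSet B) :
    T.HOverlap p A B ∧ (A.right < B.right ∨ B.left < A.left) := by
  have hlrA := hA.left_le
  have hlrB := hB.left_le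
  have hactA := hA.active_horizontal
  have hactB := hB.active_horizontal
  have hj : 1 ≤ j ∧ j ≤ n := by
    rcases hPoint_iff.1 hA'.1 with h | h <;> exact h.bounds.2
  have noDefect : ∀ {C : IndexRect}, T.IsAnchorRect p q C → T.VHull q C j → ∀ {i y : ℕ},
      1 ≤ i → i ≤ m → T.HHull p C i → ((C.left < y ∧ y < i) ∨ (i < y ∧ y < C.right)) →
      ¬ T.Defect p C j y := by
    rintro C hC hCj i y hi1 hi2 hi3 hy ⟨h1, h2, h3⟩
    have := hC.active_horizontal
    exact h3 ((vPoint_iff_mem_hIndexSet hT hAS hC (by omega) hj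
      (hi3.of_between hy) hCj h1).1 h2)
  suffices H : (A.right < B.right ∨ B.left < A.left) ∧
      ∀ i, 1 ≤ i → i ≤ m → T.HHull p A i → T.HHull p B i → T.HReach p i j by
    refine ⟨fun i hi1 hi2 hiA hiB => ?_, H.1⟩
    have hR := H.2 i hi1 hi2 hiA hiB
    rw [← vPoint_iff_mem_hIndexSet hT hAS hA ⟨hi1, hi2⟩ hj hiA hjA hR,
      ← vPoint_iff_mem_hIndexSet hT hAS hB ⟨hi1, hi2⟩ hj hiB hjB hR]
  rcases HSpan.exists_gap hA' hlrB hB' with ⟨k, h1, h2, h3⟩ | ⟨k, h1, h2, h3⟩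
  · obtain ⟨x, h4, h5, hx⟩ := exists_isTRight hT (HSpan.hPoint hA' hlrA le_rfl) h1 (by omega) h3
    refine ⟨Or.inl (by omega), fun i hi1 hi2 hiA hiB => ?_⟩
    rcases le_or_gt i x with hix | hix
    · obtain h | ⟨y, h6, h7, h8⟩ := hx.reach_or_defect_left hT hB (by omega) hix hiB
      · exact h
      · exact absurd h8 (noDefect hB hjB hi1 hi2 hiB (Or.inr ⟨h6, by omega⟩))
    · obtain h | ⟨y, h6, h7, h8⟩ := hx.reach_or_defect_right hT h4 hix hiA
      · exact h
      · exact absurd h8 (noDefect hA hjA hi1 hi2 hiA (Or.inl ⟨by omega, h7⟩))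
  · obtain ⟨x, h4, h5, hx⟩ := exists_isTLeft hT hA'.1 (by omega) h2 h3
    refine ⟨Or.inr (by omega), fun i hi1 hi2 hiA hiB => ?_⟩
    rcases le_or_gt x i with hix | hix
    · obtain h | ⟨y, h6, h7, h8⟩ := hx.reach_or_defect_right hT hB (by omega) hix hiB
      · exact h
      · exact absurd h8 (noDefect hB hjB hi1 hi2 hiB (Or.inl ⟨by omega, h7⟩))
    · obtain h | ⟨y, h6, h7, h8⟩ := hx.reach_or_defect_left hT h5 hix hiA
      · exact h
      · exact absurd h8 (noDefect hA hjA hi1 hi2 hiA (Or.inr ⟨h6, by omega⟩))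

/-- Two different anchors of an analysis-suitable T-mesh have different index vectors which
overlap, in at least one of the two directions. -/
theorem hOverlap_or_vOverlap (hT : T.IsAdmissible p q) (hAS : T.IsAnalysisSuitable p q)
    (hA : T.IsAnchorRect p q A) (hB : T.IsAnchorRect p q B) (hAB : A ≠ B) :
    (T.HOverlap p A B ∧ (A.left ≠ B.left ∨ A.right ≠ B.right)) ∨
      (T.transpose.HOverlap q A.transpose B.transpose ∧
        (A.bottom ≠ B.bottom ∨ A.top ≠ B.top)) := by
  by_cases hV : T.transpose.HOverlap q A.transpose B.transpose
  · by_cases hne : A.bottom = B.bottom ∧ A.top = B.top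
    · left
      refine ⟨fun i _ _ _ _ => ?_, ?_⟩
      · simp only [hIndexSet, hne.1, hne.2]
      · by_contra! hcon
        exact hAB (IndexRect.ext hcon.1 hcon.2 hne.1 hne.2)
    · exact Or.inr ⟨hV, by omega⟩
  · left
    simp only [HOverlap, not_forall] at hV
    obtain ⟨j, hj1, hj2, hjA, hjB, hj⟩ := hV
    rw [transpose_hIndexSet, transpose_hIndexSet] at hj
    rw [transpose_hHull] at hjA hjB
    by_cases hjm : j ∈ T.vIndexSet A
    · obtain ⟨h1, h2⟩ := HOverlap.of_line hT hAS hA hB hjA hjB hjm (by tauto)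
      exact ⟨h1, by omega⟩
    · obtain ⟨h1, h2⟩ := HOverlap.of_line hT hAS hB hA hjB hjA (by tauto) hjm
      exact ⟨fun i a b c d => (h1 i a b d c).symm, by omega⟩

end TMesh
end TSpline
end

noncomputable section
namespace TSpline
open Polynomial

/-! ### Local index vectors -/

theorem nextIndex_iterate_spec {S : Set ℕ} {a M : ℕ} (ha : a ∈ S) (haM : a < M) (k : ℕ)
    (hk : k ≤ gapCount S a M) :
    (nextIndex S)^[k] a ∈ S ∧ a ≤ (nextIndex S)^[k] a ∧ (nextIndex S)^[k] a < M ∧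
      gapCount S a M ≤ gapCount S ((nextIndex S)^[k] a) M + k := by
  induction k with
  | zero => exact ⟨ha, le_rfl, haM, le_rfl⟩
  | succ k ih =>
    rw [Function.iterate_succ_apply']
    obtain ⟨h1, h2, h3, h4⟩ := ih (by omega)
    set i := (nextIndex S)^[k] a
    obtain ⟨x, hx, hix, hxM⟩ := gapCount_pos (by omega : 0 < gapCount S i M)
    obtain ⟨h5, h6, h7⟩ := nextIndex_spec hx hix
    have := gapCount_le_add_one (S := S) (a := i) (b := M) (a' := nextIndex S i) (b' := M)
      (y := nextIndex S i) fun x hx h h' => by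
        rcases (nextIndex_spec hx h).2.2.eq_or_lt with h'' | h''
        · exact Or.inl h''.symm
        · exact Or.inr ⟨h'', h'⟩
    exact ⟨h5, by omega, by omega, by omega⟩

theorem prevIndex_iterate_spec {S : Set ℕ} {a : ℕ} (ha : a ∈ S) (ha0 : 0 < a) (k : ℕ)
    (hk : k ≤ gapCount S 0 a) :
    (prevIndex S)^[k] a ∈ S ∧ (prevIndex S)^[k] a ≤ a ∧ 0 < (prevIndex S)^[k] a ∧
      gapCount S 0 a ≤ gapCount S 0 ((prevIndex S)^[k] a) + k := by
  induction k with
  | zero => exact ⟨ha, le_rfl, ha0, le_rfl⟩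
  | succ k ih =>
    rw [Function.iterate_succ_apply']
    obtain ⟨h1, h2, h3, h4⟩ := ih (by omega)
    set i := (prevIndex S)^[k] a
    obtain ⟨x, hx, hix, hxM⟩ := gapCount_pos (by omega : 0 < gapCount S 0 i)
    obtain ⟨h5, h6, h7⟩ := prevIndex_spec hx hxM
    have := gapCount_le_add_one (S := S) (a := 0) (b := i) (a' := 0) (b' := prevIndex S i)
      (y := prevIndex S i) fun x hx h h' => by
        rcases (prevIndex_spec hx h').2.2.eq_or_lt with h'' | h''
        · exact Or.inl h''
        · exact Or.inr ⟨h, h''⟩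
    exact ⟨h5, by omega, by omega, by omega⟩

/-- The two counts ensure that no iterate falls back to the default 0, so the entries really are
consecutive elements of `S`. -/
theorem localIndex_spec {S : Set ℕ} {p a M : ℕ} (ha : a ∈ S) (haM : a < M) (ha0 : 0 < a)
    (hlow : (p + 1) / 2 ≤ gapCount S 0 a) (hhigh : p + 1 - (p + 1) / 2 ≤ gapCount S a M) :
    (∀ k ≤ p + 1, localIndex S p a k ∈ S ∧ 0 < localIndex S p a k ∧ localIndex S p a k < M) ∧
    ∀ k ≤ p, localIndex S p a k < localIndex S p a (k + 1) ∧
      ∀ z ∈ S, localIndex S p a k < z → localIndex S p a (k + 1) ≤ z := by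
  have hmem : ∀ k ≤ p + 1, localIndex S p a k ∈ S ∧ 0 < localIndex S p a k ∧
      localIndex S p a k < M := by
    intro k hk
    unfold localIndex
    split_ifs with h
    · obtain ⟨h1, h2, h3, -⟩ := nextIndex_iterate_spec ha haM (k - (p + 1) / 2) (by omega)
      exact ⟨h1, by omega, h3⟩
    · obtain ⟨h1, h2, h3, -⟩ := prevIndex_iterate_spec ha ha0 ((p + 1) / 2 - k) (by omega)
      exact ⟨h1, h3, by omega⟩
  refine ⟨hmem, fun k hk => ?_⟩
  by_cases h : (p + 1) / 2 ≤ k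
  · have e : localIndex S p a (k + 1) = nextIndex S (localIndex S p a k) := by
      unfold localIndex
      rw [if_pos h, if_pos (by omega), ← Function.iterate_succ_apply' (nextIndex S)]
      congr 2
      omega
    have hpos : 0 < gapCount S (localIndex S p a k) M := by
      have := (nextIndex_iterate_spec ha haM (k - (p + 1) / 2) (by omega)).2.2.2
      unfold localIndex
      rw [if_pos h]
      omega
    obtain ⟨x, hx, hix, hxM⟩ := gapCount_pos hpos
    rw [e]
    exact ⟨(nextIndex_spec hx hix).2.1, fun z hz hz' => (nextIndex_spec hz hz').2.2⟩
  · have e : localIndex S p a k = prevIndex S (localIndex S p a (k + 1)) := by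
      have e1 : localIndex S p a (k + 1) = (prevIndex S)^[(p + 1) / 2 - (k + 1)] a := by
        unfold localIndex
        split_ifs with h'
        · rw [show k + 1 - (p + 1) / 2 = 0 by omega, show (p + 1) / 2 - (k + 1) = 0 by omega]
          rfl
        · rfl
      rw [e1, ← Function.iterate_succ_apply' (prevIndex S)]
      unfold localIndex
      rw [if_neg h]
      congr 2
      omega
    have hpos : 0 < gapCount S 0 (localIndex S p a (k + 1)) := by
      by_contra hcon
      have h0 : prevIndex S (localIndex S p a (k + 1)) = 0 := by
        by_contra h0
        have hne : {x | x ∈ S ∧ x < localIndex S p a (k + 1)}.Nonempty := by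
          by_contra hne
          rw [Set.not_nonempty_iff_eq_empty] at hne
          exact h0 (by simp [prevIndex, hne])
        obtain ⟨x, hx, hx'⟩ := hne
        obtain ⟨h1, h2, -⟩ := prevIndex_spec hx hx'
        have : 0 < gapCount S 0 (localIndex S p a (k + 1)) :=
          (Set.ncard_pos (finite_inter_Ioo _ _ _)).2 ⟨_, h1, Nat.pos_of_ne_zero h0, h2⟩
        omega
      have := (hmem k (by omega)).2.1
      omega
    obtain ⟨x, hx, hix, hxM⟩ := gapCount_pos hpos
    rw [e]
    refine ⟨(prevIndex_spec hx hxM).2.1, fun z hz hz' => ?_⟩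
    by_contra hcon
    have := (prevIndex_spec hz (not_le.1 hcon)).2.2
    omega

theorem exists_eq_of_consecutive {S : Set ℕ} {α : ℕ → ℕ} (K : ℕ)
    (hα : ∀ k < K, ∀ z ∈ S, α k < z → α (k + 1) ≤ z) {z : ℕ} (hz : z ∈ S) (h0 : α 0 ≤ z)
    (hK : z ≤ α K) : ∃ k ≤ K, α k = z := by
  induction K with
  | zero => exact ⟨0, le_rfl, by omega⟩
  | succ K ih =>
    rcases le_or_gt z (α K) with h | h
    · obtain ⟨k, hk, hkz⟩ := ih (fun k hk => hα k (by omega)) h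
      exact ⟨k, by omega, hkz⟩
    · exact ⟨K + 1, le_rfl, le_antisymm (hα K (by omega) z hz h) hK⟩

/-! ### Index vectors of anchors -/

namespace TMesh

variable {m n p q : ℕ} {T : TMesh m n} {A B : IndexRect}

/-- The horizontal index vector of the anchor `A`. -/
def hIndex (T : TMesh m n) (p : ℕ) (A : IndexRect) : ℕ → ℕ :=
  localIndex (T.hIndexSet A) p A.left

theorem IsAnchorRect.mem_hIndexSet (hT : T.IsAdmissible p q) (hn : 2 ≤ n)
    (hA : T.IsAnchorRect p q A) {i : ℕ} (h1 : 1 ≤ i) (h2 : i ≤ m)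
    (h : i ≤ 1 + (p + 1) / 2 ∨ m ≤ i + (p + 1) / 2) : i ∈ T.hIndexSet A := by
  have hact := hA.active_vertical
  have hbt : A.bottom ≤ A.top := hA.transpose.left_le
  refine ⟨vPoint_iff.2 ?_, fun j h3 h4 => hT.vertical_lines i j h1 h2 (by omega) (by omega) h⟩
  rcases (show A.bottom ≤ n by omega).lt_or_eq with h3 | h3
  · exact Or.inl (hT.vertical_lines i _ h1 h2 (by omega) h3 h)
  · exact Or.inr (hT.vertical_lines i _ h1 h2 (by omega) (by omega) h)

theorem IsAnchorRect.hIndex_spec (hT : T.IsAdmissible p q) (hn : 2 ≤ n)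
    (hA : T.IsAnchorRect p q A) :
    (∀ k ≤ p + 1, T.hIndex p A k ∈ T.hIndexSet A ∧ 0 < T.hIndex p A k ∧
      T.hIndex p A k < m + 1) ∧
    ∀ k ≤ p, T.hIndex p A k < T.hIndex p A (k + 1) ∧
      ∀ z ∈ T.hIndexSet A, T.hIndex p A k < z → T.hIndex p A (k + 1) ≤ z := by
  have hact := hA.active_horizontal
  have hlr := hA.left_le
  refine localIndex_spec hA.left_mem (by omega) (by omega) ?_ ?_
  · have := le_gapCount (S := T.hIndexSet A) (a := 1) (b := (p + 1) / 2) (l := 0) (r := A.left)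
      (fun x h1 h2 => hA.mem_hIndexSet hT hn h1 (by omega) (by omega)) (by omega) (by omega)
    omega
  -- The frame supplies `(p + 1) / 2` columns, which suffices for odd `p`. For even `p` one more
  -- step is needed, and `A.right` supplies it.
  · have h1 := le_gapCount (S := T.hIndexSet A) (a := m - (p + 1) / 2 + 1) (b := m)
      (l := A.right) (r := m + 1)
      (fun x h1 h2 => hA.mem_hIndexSet hT hn (by omega) h2 (by omega)) (by omega) (by omega)
    rcases hA.horizontal with ⟨hp, h⟩ | ⟨hp, h⟩
    · have := Nat.odd_iff.1 hp
      rw [h]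
      omega
    · have h2 := gapCount_lt (S := T.hIndexSet A) (S' := T.hIndexSet A) (a := A.right)
        (b := m + 1) (a' := A.left) (b' := m + 1) h.le le_rfl (fun x hx _ _ => hx) hA.right_mem h
        (by omega) (Or.inl le_rfl)
      have := Nat.even_iff.1 hp
      omega

theorem IsAnchorRect.hHull_of_mem (hA : T.IsAnchorRect p q A) {z : ℕ} (h0 : T.hIndex p A 0 ≤ z)
    (h1 : z ≤ T.hIndex p A (p + 1)) : T.HHull p A z := by
  have hlr := hA.left_le
  refine ⟨or_iff_not_imp_left.2 fun hz => ?_, or_iff_not_imp_left.2 fun hz => ?_⟩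
  · rw [hIndex, localIndex, if_pos (by omega)] at h1
    have h2 := gapCount_lt_of_le_nextIndex_iterate _ (by omega) h1
    rcases hA.horizontal with ⟨hp, h⟩ | ⟨hp, h⟩
    · have := Nat.odd_iff.1 hp
      rw [← h]
      omega
    · have h3 := gapCount_lt (S := T.hIndexSet A) (S' := T.hIndexSet A) (a := A.right)
        (b := z) (a' := A.left) (b' := z) h.le le_rfl (fun x hx _ _ => hx) hA.right_mem h
        (by omega) (Or.inl le_rfl)
      have := Nat.even_iff.1 hp
      omega
  · refine gapCount_lt_of_prevIndex_iterate_le _ (by omega) (le_trans (le_of_eq ?_) h0)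
    rw [hIndex, localIndex]
    split_ifs with h
    · rw [show (p + 1) / 2 = 0 by omega]
      rfl
    · rfl

theorem HOverlap.overlap (hT : T.IsAdmissible p q) (hn : 2 ≤ n) (hA : T.IsAnchorRect p q A)
    (hB : T.IsAnchorRect p q B) (h : T.HOverlap p A B) :
    Overlap p (T.hIndex p A) (T.hIndex p B) := by
  have hA' := hA.hIndex_spec hT hn
  have hB' := hB.hIndex_spec hT hn
  intro z hA0 hA1 hB0 hB1
  have hz1 := (hA'.1 0 (by omega)).2.1
  have hz2 := (hA'.1 (p + 1) (by omega)).2.2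
  have hiff := h z (by omega) (by omega) (hA.hHull_of_mem hA0 hA1) (hB.hHull_of_mem hB0 hB1)
  constructor
  · rintro ⟨k, hk, rfl⟩
    exact exists_eq_of_consecutive (p + 1) (fun k hk => (hB'.2 k (by omega)).2)
      (hiff.1 (hA'.1 k hk).1) hB0 hB1
  · rintro ⟨k, hk, rfl⟩
    exact exists_eq_of_consecutive (p + 1) (fun k hk => (hA'.2 k (by omega)).2)
      (hiff.2 (hB'.1 k hk).1) hA0 hA1

theorem hIndex_left (T : TMesh m n) (p : ℕ) (A : IndexRect) :
    T.hIndex p A ((p + 1) / 2) = A.left := by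
  simp [hIndex, localIndex]

theorem IsAnchorRect.hIndex_right (hA : T.IsAnchorRect p q A) (h : A.left < A.right) :
    T.hIndex p A ((p + 1) / 2 + 1) = A.right := by
  rw [hIndex, localIndex, if_pos (by omega), Nat.add_sub_cancel_left, Function.iterate_one]
  obtain ⟨h1, h2, h3⟩ := nextIndex_spec hA.right_mem h
  by_contra hne
  exact hA.horizontal_gap _ h2 (by omega) h1

theorem IsAnchorRect.hIndex_ne (hA : T.IsAnchorRect p q A) (hB : T.IsAnchorRect p q B)
    (h : A.left ≠ B.left ∨ A.right ≠ B.right) :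
    ∃ k ≤ p + 1, T.hIndex p A k ≠ T.hIndex p B k := by
  by_contra! hcon
  have h1 := hcon ((p + 1) / 2) (by omega)
  rw [hIndex_left, hIndex_left] at h1
  rcases hA.horizontal with ⟨hp, hA'⟩ | ⟨hp, hA'⟩
  · rcases hB.horizontal with ⟨_, hB'⟩ | ⟨hp', _⟩
    · omega
    · exact Nat.not_even_iff_odd.2 hp hp'
  · rcases hB.horizontal with ⟨hp', _⟩ | ⟨_, hB'⟩
    · exact Nat.not_even_iff_odd.2 hp' hp
    · have h2 := hcon ((p + 1) / 2 + 1) (by omega)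
      rw [hA.hIndex_right hA', hB.hIndex_right hB'] at h2
      omega

end TMesh

/-! ### Linear independence -/

theorem exists_knot_free_interval (s : ℕ → ℝ) (M : ℕ) {u U : ℝ} (h : u < U) :
    ∃ v, u < v ∧ v ≤ U ∧ ∀ k < M, s k ≤ u ∨ v ≤ s k := by
  induction M with
  | zero => exact ⟨U, h, le_rfl, fun k hk => absurd hk (Nat.not_lt_zero k)⟩
  | succ M ih =>
    obtain ⟨v, h1, h2, h3⟩ := ih
    rcases le_or_gt (s M) u with hM | hM
    · refine ⟨v, h1, h2, fun k hk => ?_⟩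
      rcases Nat.lt_succ_iff_lt_or_eq.1 hk with hk | rfl
      · exact h3 k hk
      · exact Or.inl hM
    · refine ⟨min v (s M), lt_min h1 hM, (min_le_left _ _).trans h2, fun k hk => ?_⟩
      rcases Nat.lt_succ_iff_lt_or_eq.1 hk with hk | rfl
      · exact (h3 k hk).imp_right (min_le_left _ _).trans
      · exact Or.inr (min_le_right _ _)

/-- Vanishing on an interval is vanishing as a polynomial, to which any functional may be applied.
-/
theorem functional_sum_eq_zero {ι : Type*} (I : Finset ι) (g : ι → ℝ) (F : ι → ℝ[X])
    (L : ℝ[X] →ₗ[ℝ] ℝ) {u v : ℝ} (huv : u < v)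
    (h : ∀ x ∈ Set.Ico u v, ∑ i ∈ I, g i * (F i).eval x = 0) : ∑ i ∈ I, g i * L (F i) = 0 := by
  have h0 : ∑ i ∈ I, g i • F i = 0 := by
    refine eq_zero_of_infinite_isRoot _ ((Set.Ico_infinite huv).mono fun x hx => ?_)
    rw [Set.mem_ofPred_eq, IsRoot.def, eval_finsetSum, ← h x hx]
    simp
  have := congrArg L h0
  simpa using this

/-- A coefficient of a vanishing combination of products of polynomials is zero if there are
functionals that separate its product from the others. -/
theorem coeff_eq_zero_of_functionals {ι : Type*} {I : Finset ι} {g : ι → ℝ} {F G : ι → ℝ[X]}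
    {a : ι} (ha : a ∈ I) (L M : ℝ[X] →ₗ[ℝ] ℝ) (hL : L (F a) = 1) (hM : M (G a) = 1)
    (hLM : ∀ b ∈ I, b ≠ a → L (F b) = 0 ∨ M (G b) = 0) {u v u' v' : ℝ} (huv : u < v)
    (huv' : u' < v') (h : ∀ x ∈ Set.Ico u v, ∀ y ∈ Set.Ico u' v',
      ∑ i ∈ I, g i * ((F i).eval x * (G i).eval y) = 0) : g a = 0 := by
  have h1 : ∀ y ∈ Set.Ico u' v', ∑ i ∈ I, (g i * L (F i)) * (G i).eval y = 0 := by
    intro y hy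
    rw [← functional_sum_eq_zero I (fun i => g i * (G i).eval y) F L huv fun x hx => by
      rw [← h x hx y hy]
      exact Finset.sum_congr rfl fun i _ => by ring]
    exact Finset.sum_congr rfl fun i _ => by ring
  have h2 := functional_sum_eq_zero I _ G M huv' h1
  rw [Finset.sum_eq_single a (fun b hb hba => ?_) (fun h => absurd ha h)] at h2
  · simpa [hL, hM] using h2
  · rcases hLM b hb hba with h | h <;> simp [h]

/-- Outside `1, …, m` the values of `s` are arbitrary. Clamping gives a monotone sequence without
changing any knot that occurs in an index vector. -/
theorem IsOpenKnotVector.monotone_clamp {p m : ℕ} {s : ℕ → ℝ} (hs : IsOpenKnotVector p m s) :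
    Monotone fun k => s (max 1 (min k m)) := fun i j hij => by
  have := hs.length
  exact hs.mono _ _ (by omega) (by omega) (by omega)

namespace TMesh

variable {m n p q : ℕ} {T : TMesh m n} {A B : IndexRect} {s : ℕ → ℝ}

/-- The polynomial that coincides, immediately to the right of `u`, with the horizontal factor of
the blending function of the anchor `A`. -/
def hPiece (T : TMesh m n) (p : ℕ) (s : ℕ → ℝ) (u : ℝ) (A : IndexRect) : ℝ[X] :=
  bsplinePiece (fun k => s (T.hIndex p A k)) u p 0

theorem IsAnchorRect.hPiece_clamp (hT : T.IsAdmissible p q) (hn : 2 ≤ n)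
    (hA : T.IsAnchorRect p q A) (s : ℕ → ℝ) (u : ℝ) :
    T.hPiece p s u A = bsplinePiece (fun k => s (max 1 (min (T.hIndex p A k) m))) u p 0 := by
  refine bsplinePiece_congr u p 0 0 fun r hr => ?_
  have := (hA.hIndex_spec hT hn).1 r hr
  simp only [zero_add]
  congr 1
  omega

theorem IsAnchorRect.eval_hPiece (hT : T.IsAdmissible p q) (hn : 2 ≤ n)
    (hA : T.IsAnchorRect p q A) {u v : ℝ} (hv : ∀ k < m + 1, s k ≤ u ∨ v ≤ s k) {x : ℝ}
    (hx : x ∈ Set.Ico u v) :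
    bspline (fun k => s (T.hIndex p A k)) p 0 x = (T.hPiece p s u A).eval x :=
  bspline_eq_eval p 0 (fun k _ hk => hv _ ((hA.hIndex_spec hT hn).1 k (by omega)).2.2) hx

theorem IsAnchorRect.exists_functional (hT : T.IsAdmissible p q) (hn : 2 ≤ n)
    (hs : IsOpenKnotVector p m s) (hA : T.IsAnchorRect p q A) {u : ℝ}
    (hu : T.hPiece p s u A ≠ 0) :
    ∃ L : ℝ[X] →ₗ[ℝ] ℝ, L (T.hPiece p s u A) = 1 ∧ ∀ B, T.IsAnchorRect p q B →
      T.HOverlap p A B → (A.left ≠ B.left ∨ A.right ≠ B.right) → L (T.hPiece p s u B) = 0 := by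
  rw [hA.hPiece_clamp hT hn] at hu ⊢
  obtain ⟨L, hL, hL'⟩ := exists_dual_functional hs.monotone_clamp
    (fun k hk => ((hA.hIndex_spec hT hn).2 k hk).1) hu
  refine ⟨L, hL, fun B hB hAB hne => ?_⟩
  rw [hB.hPiece_clamp hT hn]
  exact hL' _ (fun k hk => ((hB.hIndex_spec hT hn).2 k hk).1) (hAB.overlap hT hn hA hB)
    (hA.hIndex_ne hB hne)

theorem blending_eq (T : TMesh m n) (p q : ℕ) (s t : ℕ → ℝ) (A : IndexRect) (x : ℝ × ℝ) :
    T.blending p q s t A x = bspline (fun k => s (T.hIndex p A k)) p 0 x.1 *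
      bspline (fun k => t (T.transpose.hIndex q A.transpose k)) q 0 x.2 := by
  rw [blending, hIndex, hIndex, transpose_hIndexSet]
  rfl

end TMesh
end TSpline
end

theorem theorem4p2 (p q m n : ℕ) (s t : ℕ → ℝ)
    (hs : TSpline.IsOpenKnotVector p m s) (ht : TSpline.IsOpenKnotVector q n t)
    (T : TSpline.TMesh m n) (hT : T.IsAdmissible p q) (hAS : T.IsAnalysisSuitable p q)
    (E : TSpline.IndexRect) (hE : T.IsBezierElement p q s t E) :
    LinearIndependent ℝ
      (fun (A : T.activeAnchors p q s t E) (x : TSpline.paramDomain s t E) =>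
        T.blending p q s t A x) := by
  have hm : 2 ≤ m := by have := hs.length; omega
  have hn : 2 ≤ n := by have := ht.length; omega
  rw [linearIndependent_iff']
  intro I g hg A hAI
  obtain ⟨hA, ⟨u, u'⟩, ⟨⟨hu1, hu2⟩, hu1', hu2'⟩, hx⟩ := A.2
  have hR : ∀ B : T.activeAnchors p q s t E, T.IsAnchorRect p q B := fun B => B.2.1.isAnchorRect
  -- The box lies up and to the right of the chosen point because B-splines are right-continuous;
  -- its lower left corner witnesses that both factors of `N_A` are nonzero polynomials.
  obtain ⟨v, huv, hvE, hv⟩ := TSpline.exists_knot_free_interval s (m + 1) hu2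
  obtain ⟨v', huv', hvE', hv'⟩ := TSpline.exists_knot_free_interval t (n + 1) hu2'
  have hbl : ∀ B : T.activeAnchors p q s t E, ∀ x ∈ Set.Ico u v, ∀ y ∈ Set.Ico u' v',
      T.blending p q s t B (x, y) = (T.hPiece p s u B).eval x *
        (T.transpose.hPiece q t u' (TSpline.IndexRect.transpose B)).eval y := by
    intro B x hx y hy
    rw [TSpline.TMesh.blending_eq, (hR B).eval_hPiece hT hn hv hx,
      (hR B).transpose.eval_hPiece hT.transpose hm hv' hy]
  have hne := hbl A u ⟨le_rfl, huv⟩ u' ⟨le_rfl, huv'⟩ ▸ hx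
  obtain ⟨L, hL, hL'⟩ := (hR A).exists_functional hT hn hs (u := u)
    fun h => hne (by rw [h, Polynomial.eval_zero, zero_mul])
  obtain ⟨M, hM, hM'⟩ := (hR A).transpose.exists_functional hT.transpose hm ht (u := u')
    fun h => hne (by rw [h, Polynomial.eval_zero, mul_zero])
  refine TSpline.coeff_eq_zero_of_functionals (g := g)
    (F := fun B : T.activeAnchors p q s t E => T.hPiece p s u B)
    (G := fun B : T.activeAnchors p q s t E =>
      T.transpose.hPiece q t u' (TSpline.IndexRect.transpose B))
    hAI L M hL hM ?_ huv huv' ?_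
  · intro B _ hBA
    obtain h | h := TSpline.TMesh.hOverlap_or_vOverlap hT hAS (hR A) (hR B)
      fun h => hBA (Subtype.ext h.symm)
    · exact Or.inl (hL' _ (hR B) h.1 h.2)
    · exact Or.inr (hM' _ (hR B).transpose h.1 h.2)
  · intro x hx y hy
    have := congrFun hg ⟨(x, y), ⟨hu1.trans_le hx.1, hx.2.trans_le hvE⟩,
      hu1'.trans_le hy.1, hy.2.trans_le hvE'⟩
    simp only [Finset.sum_apply, Pi.smul_apply, smul_eq_mul, Pi.zero_apply] at this
    rw [← this]
    exact Finset.sum_congr rfl fun B _ => by rw [hbl B x hx y hy]
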